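/- Let $P_{Z|X}$ be a Markov kernel from a measurable space $\mathcal X$ to a measurable space $\mathcal Z$, let $Q$ be a probability measure on $\mathcal Z$ and let $\alpha\in(1,\infty]$. The Poisson private representation (PPR) with parameter $\alpha$, proposal distribution $Q$ and simulated mechanism $P_{Z|X}$ is the following scheme, for an input $X$ such that $P_{Z|X}(\cdot|X)\ll Q$ almost surely. Let $Z_1,Z_2,\ldots$ be i.i.d. with law $Q$, let $0<T_1<T_2<\cdots$ be a Poisson process of rate $1$ (that is, $T_1,T_2-T_1,T_3-T_2,\ldots$ are i.i.d. $\mathrm{Exp}(1)$), and let $X$, $(Z_i)_i$, $(T_i)_i$ be independent. Put $P:=P_{Z|X}(\cdot|X)$ and $\tilde T_i:=T_i\cdot\left(\frac{\mathrm dP}{\mathrm dQ}(Z_i)\right)^{-1}$, with $\tilde T_i=\infty$ if $\frac{\mathrm dP}{\mathrm dQ}(Z_i)=0$, where the density $\frac{\mathrm dP_{Z|X}(\cdot|x)}{\mathrm dQ}(z)$ is taken jointly measurable in $(x,z)$. Given $X$, $(T_i)_i$ and $(Z_i)_i$, the message $K\in\{1,2,\ldots\}$ is drawn with $$\Pr(K=k)=\frac{\tilde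 T_k^{-\alpha}}{\sum_{i=1}^\infty\tilde T_i^{-\alpha}},$$ and for $\alpha=\infty$ one takes $K:=\mathrm{argmin}_i\,\tilde T_i$. Let $\log$, the relative entropy $D(\cdot\Vert\cdot)$ and the mutual information $I(\cdot;\cdot)$ be to the same base, say $e$. Write $$a_\alpha:=\frac{\log(3.56)}{\min\{(\alpha-1)/2,\,1\}},\qquad b_\alpha:=\inf_{\eta\in(0,1]\cap(0,\alpha-1)}\frac1\eta\log\left(\frac{\Gamma\left(1-\frac{\eta+1}{\alpha}\right)\Gamma(\eta+1)}{\Gamma\left(1-\frac1\alpha\right)^{\eta+1}}+1\right),$$ where $1/\alpha=0$ and the minimum is $1$ if $\alpha=\infty$. **Theorem.** 1. If the input is a fixed $x\in\mathcal X$, and $P:=P_{Z|X}(\cdot|x)$, then $\mathbb E[\log K]\le D(P\Vert Q)+a_\alpha$ and, more precisely, $\mathbb E[\log K]\le D(P\Vert Q)+b_\alpha$. 2. If the input $X\sim P_X$ is random and $Q=P_Z$ is the $Z$-marginal of $P_XP_{Z|X}$, then $\mathbb E[\log K]\le I(X;Z)+a_\alpha$ and, more precisely, $\mathbb E[\log K]\le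 I(X;Z)+b_\alpha$, where $I(X;Z)$ is computed for $(X,Z)\sim P_XP_{Z|X}$. 3. $b_\alpha\le a_\alpha$. The right-hand sides in 1 and 2 may be $+\infty$. -/

import Mathlib

open MeasureTheory ProbabilityTheory InformationTheory
open scoped ENNReal ProbabilityTheory

noncomputable section

namespace PPR

/-- The inter-arrival times `T₀, T₁ - T₀, T₂ - T₁, …` of a sequence `T` of arrival times. -/
def gap (T : ℕ → ℝ) : ℕ → ℝ
  | 0 => T 0
  | n + 1 => T (n + 1) - T n

/-- The tilted arrival times `T̃ᵢ = Tᵢ · (dP/dQ(Zᵢ))⁻¹`, where `f` is the density `dP/dQ`.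
The quotient is taken in `[0, ∞]`, so that `T̃ᵢ = ∞` when `f (Zᵢ) = 0` (and `Tᵢ > 0`). -/
def tilted {𝒵 : Type*} (f : 𝒵 → ℝ≥0∞) (t : ℕ → ℝ) (z : ℕ → 𝒵) (i : ℕ) : ℝ≥0∞ :=
  ENNReal.ofReal (t i) / f (z i)

open Classical in
/-- The probability with which the encoder selects the point number `k` when the tilted arrival
times are `τ`: it is `τ_k ^ (-α) / ∑ᵢ τᵢ ^ (-α)` when `α < ∞`, while for `α = ∞` the encoder
selects the (first) index at which `τ` is minimal. -/
def selectProb (α : ℝ≥0∞) (τ : ℕ → ℝ≥0∞) (k : ℕ) : ℝ≥0∞ :=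
  if α = ∞ then
    if (∀ j, τ k ≤ τ j) ∧ ∀ j < k, τ k < τ j then 1 else 0
  else τ k ^ (-α.toReal) / ∑' i, τ i ^ (-α.toReal)

/-- `IsPPR α Q κ r μ X T Z K`: on the probability space `(Ω, μ)`, the random variables
`X` (input), `T` (Poisson process of the encoder), `Z` (shared randomness) and `K` (message)
are those of the Poisson private representation with parameter `α`, proposal distribution `Q` and
simulated mechanism `κ = P_{Z|X}`. The function `r x` is a version of the density `dκ(x)/dQ`.
The points of the process are numbered `0, 1, 2, …` whereas `K` takes the values `1, 2, 3, …`, so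
`K = k.succPNat` (that is, `K = k + 1`) says that the point number `k` is selected. -/
structure IsPPR {𝒳 𝒵 Ω : Type*} [MeasurableSpace 𝒳] [MeasurableSpace 𝒵] [MeasurableSpace Ω]
    (α : ℝ≥0∞) (Q : Measure 𝒵) (κ : Kernel 𝒳 𝒵) (r : 𝒳 → 𝒵 → ℝ≥0∞) (μ : Measure Ω)
    (X : Ω → 𝒳) (T : ℕ → Ω → ℝ) (Z : ℕ → Ω → 𝒵) (K : Ω → ℕ+) : Prop where
  measurable_X : Measurable X
  measurable_T : ∀ i, Measurable (T i)
  measurable_Z : ∀ i, Measurable (Z i)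
  measurable_K : ∀ k, MeasurableSet {ω | K ω = k}
  /-- `r` is jointly measurable. -/
  measurable_r : Measurable (Function.uncurry r)
  /-- Almost surely, `κ (X)` is absolutely continuous with respect to `Q`. -/
  ac : ∀ᵐ ω ∂μ, κ (X ω) ≪ Q
  /-- Almost surely, `r (X)` is a density of `κ (X)` with respect to `Q`. -/
  density : ∀ᵐ ω ∂μ, r (X ω) =ᵐ[Q] (κ (X ω)).rnDeriv Q
  /-- `T` is a Poisson process of rate `1`: its inter-arrival times are i.i.d. `Exp(1)`. -/
  iIndep_gap : iIndepFun (fun i ω => gap (fun n => T n ω) i) μ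
  law_gap : ∀ i, HasLaw (fun ω => gap (fun n => T n ω) i) (expMeasure 1) μ
  /-- The `Z i` are i.i.d. with law `Q`. -/
  iIndep_Z : iIndepFun Z μ
  law_Z : ∀ i, HasLaw (Z i) Q μ
  /-- `T`, `Z` and the input are independent. -/
  indep_T_Z : IndepFun (fun ω i => T i ω) (fun ω i => Z i ω) μ
  indep_X : IndepFun X (fun ω => ((fun i => T i ω), (fun i => Z i ω))) μ
  /-- The conditional distribution of `K` given `(X, T, Z)`. -/
  cond_law : ∀ (k : ℕ) (A : Set (𝒳 × (ℕ → ℝ) × (ℕ → 𝒵))), MeasurableSet A →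
    μ {ω | K ω = k.succPNat ∧ (X ω, (fun i => T i ω), (fun i => Z i ω)) ∈ A} =
      ∫⁻ ω in {ω | (X ω, (fun i => T i ω), (fun i => Z i ω)) ∈ A},
        selectProb α (tilted (r (X ω)) (fun i => T i ω) (fun i => Z i ω)) k ∂μ

/-- `E[log K]`, as an element of `[0, ∞]` (`log K ≥ 0` since `K ≥ 1`). Natural logarithm. -/
def expLog {Ω : Type*} [MeasurableSpace Ω] (μ : Measure Ω) (K : Ω → ℕ+) : ℝ≥0∞ :=
  ∫⁻ ω, ENNReal.ofReal (Real.log ((K ω : ℕ) : ℝ)) ∂μ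

/-- The mutual information `I(X;Z)` of a pair `(X, Z)` with joint law `ρ`, in nats: the
relative entropy of `ρ` with respect to the product of its marginals. -/
def mutualInfo {𝒳 𝒵 : Type*} [MeasurableSpace 𝒳] [MeasurableSpace 𝒵] (ρ : Measure (𝒳 × 𝒵)) :
    ℝ≥0∞ :=
  klDiv ρ (ρ.fst.prod ρ.snd)

/-- The constant `log(3.56) / min{(α - 1)/2, 1}`; the minimum is `1` for `α = ∞`. -/
def simpleGap (α : ℝ≥0∞) : ℝ≥0∞ :=
  ENNReal.ofReal (Real.log 3.56 / (min ((α - 1) / 2) 1).toReal)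

/-- `Γ(1 - (η+1)/α) Γ(η+1) / Γ(1 - 1/α)^(η+1)`, where `1/α = 0` for `α = ∞`. -/
def gammaCoeff (α : ℝ≥0∞) (η : ℝ) : ℝ :=
  Real.Gamma (1 - (η + 1) * (α⁻¹).toReal) * Real.Gamma (η + 1) /
    Real.Gamma (1 - (α⁻¹).toReal) ^ (η + 1)

/-- The infimum over `η ∈ (0, 1] ∩ (0, α - 1)` of `η⁻¹ log(gammaCoeff α η + 1)`. -/
def refinedGap (α : ℝ≥0∞) : ℝ≥0∞ :=
  ⨅ η ∈ {η : ℝ | 0 < η ∧ η ≤ 1 ∧ ENNReal.ofReal η < α - 1},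
    ENNReal.ofReal (1 / η * Real.log (gammaCoeff α η + 1))

end PPR

end

/-!
The selected index exceeds by one the number of arrivals before the selected one, so `log K` is
controlled once the law of the process seen from the selected point is understood.

Write `f = dP/dQ`, `τᵢ = Tᵢ / f(Zᵢ)` and `c = Γ(1 - 1/α)`. For finite `α` the selection probability
is linearised by
`τ_k^{-α} / ∑ᵢ τᵢ^{-α} = ∫₀^∞ τ_k^{-α} exp (-s τ_k^{-α}) ∏_{i ≠ k} exp (-s τᵢ^{-α}) ds`
(`div_tsum_le_lintegral`), so that for each fixed `s` the points other than the `k`-th enter through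
a product `∏ φ(τᵢ)` with `0 ≤ φ ≤ 1`. Conditionally on the arrival times the marks are integrated
out, which replaces `φ(τᵢ)` by `Φ(Tᵢ)`, where `Φ(t) = ∫ φ(t / f) dQ`. With `A(t) = ∫₀ᵗ Φ`, the
arrivals before the `k`-th contribute `A(t)ᵏ / k!` to the density at `T_k = t`, and those after it
are handled by the supermartingale `∏_{i ≤ n} Φ(Tᵢ) exp (Tₙ - A(Tₙ))`
(`IsPoissonArrivals.lintegral_mul_prod_le`). Weighting by `φ` thus turns the number of earlier
arrivals into a Poisson variable of mean `A(t) ≤ t`, and Jensen's inequality bounds the expectation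
of `log (1 + N)` by `log (1 + t)`. The substitution `t = u f(z)` yields
`IsMarkedPoisson.tsum_log_mul_lintegral_le`, and integration over `s` gives
`E log K ≤ ∫∫ f(z) log (1 + u f(z)) w(u) du Q(dz)`,
where `w` is the density `∫₀^∞ u^{-α} exp (-s u^{-α}) exp (-c s^{1/α}) ds` on `(0, ∞)`. It has total
mass `1`, and its moment of order `η` is exactly the coefficient `gammaCoeff α η`. For `α = ∞`
the density is `e^{-u}`; there the event that `τ_k` is minimal is decomposed according to the cell
`[lε, (l + 1)ε)` that contains `τ_k`, and `ε` tends to `0`.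

The relative entropy appears through
`log (1 + u f) ≤ η⁻¹ log (1 + u^η f^η) = log f + η⁻¹ log (f^{-η} + u^η)`
and Jensen's inequality in `u` and in `z`, as `∫ f^{1-η} dQ ≤ 1`
(`lintegral_mul_log_one_add_mul_le`). For a random input the bound is averaged over the input, and
the averaged relative entropy is the mutual information when `Q` is the output distribution.

The refined constant is compared with the simple one at `η = min ((α - 1)/2, 1)`, with the
elementary bounds `(1 + b)^{b - 1} ≤ Γ(1 + b) ≤ 1` for `0 < b ≤ 1`.
-/

namespace PPR

/-! ### Integrals of functions of a cumulative integral -/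

/-- The cumulative integral `t ↦ ∫₀ᵗ φ` of a function on the line. -/
noncomputable def accum (φ : ℝ → ℝ) (t : ℝ) : ℝ := ∫ s in (0 : ℝ)..t, φ s

section accum

variable {φ : ℝ → ℝ} (hφ : Measurable φ) (h0 : ∀ t, 0 ≤ φ t) (h1 : ∀ t, φ t ≤ 1)

include hφ h0 h1

lemma locallyIntegrable_of_mem_Icc : LocallyIntegrable φ volume := by
  refine (locallyIntegrable_const (1 : ℝ)).mono hφ.aestronglyMeasurable (ae_of_all _ fun t => ?_)
  simpa [abs_of_nonneg (h0 t)] using h1 t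

lemma intervalIntegrable_of_mem_Icc (a b : ℝ) : IntervalIntegrable φ volume a b :=
  intervalIntegrable_iff.mpr <| (LocallyIntegrable.integrableOn_isCompact
    (locallyIntegrable_of_mem_Icc hφ h0 h1) isCompact_uIcc).mono_set Set.uIoc_subset_uIcc

lemma accum_sub (a b : ℝ) : accum φ b - accum φ a = ∫ s in a..b, φ s :=
  intervalIntegral.integral_interval_sub_left
    (intervalIntegrable_of_mem_Icc hφ h0 h1 _ _) (intervalIntegrable_of_mem_Icc hφ h0 h1 _ _)

lemma accum_mono : Monotone (accum φ) := fun a b hab => by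
  rw [← sub_nonneg, accum_sub hφ h0 h1]
  exact intervalIntegral.integral_nonneg hab fun t _ => h0 t

lemma accum_nonneg {t : ℝ} (ht : 0 ≤ t) : 0 ≤ accum φ t := by
  simpa [accum] using accum_mono hφ h0 h1 ht

lemma accum_sub_le {a b : ℝ} (hab : a ≤ b) : accum φ b - accum φ a ≤ b - a := by
  rw [accum_sub hφ h0 h1]
  calc ∫ s in a..b, φ s ≤ ∫ _ in a..b, (1 : ℝ) :=
        intervalIntegral.integral_mono_on hab (intervalIntegrable_of_mem_Icc hφ h0 h1 _ _)
          (by simp) fun t _ => h1 t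
    _ = b - a := by simp

lemma accum_le {t : ℝ} (ht : 0 ≤ t) : accum φ t ≤ t := by
  simpa [accum] using accum_sub_le hφ h0 h1 ht

lemma lipschitzWith_accum : LipschitzWith 1 (accum φ) := by
  refine LipschitzWith.of_le_add_mul 1 fun x y => ?_
  rcases le_total x y with h | h
  · have := accum_mono hφ h0 h1 h
    have := dist_nonneg (x := x) (y := y)
    simp; linarith
  · have := accum_sub_le hφ h0 h1 h
    rw [Real.dist_eq, abs_of_nonneg (by linarith)]
    simp; linarith

lemma measurable_accum : Measurable (accum φ) :=
  (lipschitzWith_accum hφ h0 h1).continuous.measurable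

/-- Change of variables for the (merely Lipschitz) substitution `t ↦ ∫₀ᵗ φ`. -/
lemma integral_mul_deriv_comp_accum {G : ℝ → ℝ} (hG : ContDiff ℝ 1 G) (a b : ℝ) :
    ∫ t in a..b, φ t * deriv G (accum φ t) = G (accum φ b) - G (accum φ a) := by
  obtain ⟨C, hC⟩ : ∃ C, LipschitzOnWith C G (accum φ '' Set.uIcc a b) := by
    refine (hG.locallyLipschitz.locallyLipschitzOn).exists_lipschitzOnWith_of_compact ?_
    exact isCompact_uIcc.image (lipschitzWith_accum hφ h0 h1).continuous
  have hlip : LipschitzOnWith (C * 1) (G ∘ accum φ) (Set.uIcc a b) :=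
    hC.comp (lipschitzWith_accum hφ h0 h1).lipschitzOnWith (Set.mapsTo_image _ _)
  have hac := hlip.absolutelyContinuousOnInterval
  have := hac.integral_deriv_eq_sub
  simp only [Function.comp] at this
  rw [← this]
  refine intervalIntegral.integral_congr_ae ?_
  filter_upwards [LocallyIntegrable.ae_hasDerivAt_integral
    (locallyIntegrable_of_mem_Icc hφ h0 h1)] with t ht _
  have h2 : HasDerivAt (accum φ) (φ t) t := ht 0
  have h3 : HasDerivAt G (deriv G (accum φ t)) (accum φ t) :=
    (hG.differentiable one_ne_zero _).hasDerivAt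
  rw [(h3.comp t h2).deriv, mul_comm]

lemma lintegral_mul_accum_pow (k : ℕ) {v : ℝ} (hv : 0 ≤ v) :
    ∫⁻ t in Set.Ioo 0 v, ENNReal.ofReal (φ t) * ENNReal.ofReal (accum φ t ^ k / k.factorial) =
      ENNReal.ofReal (accum φ v ^ (k + 1) / (k + 1).factorial) := by
  have hderiv : ∀ x : ℝ, deriv (fun x : ℝ => x ^ (k + 1) / (k + 1).factorial) x
      = x ^ k / k.factorial := fun x => by
    rw [deriv_div_const, deriv_pow_field]
    rw [Nat.factorial_succ]; push_cast
    have : (k.factorial : ℝ) ≠ 0 := by positivity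
    field_simp
  have key := integral_mul_deriv_comp_accum hφ h0 h1
    (G := fun x : ℝ => x ^ (k + 1) / (k + 1).factorial) (by fun_prop) 0 v
  simp only [hderiv] at key
  have hA0 : accum φ 0 = 0 := by simp [accum]
  rw [hA0] at key
  simp only [zero_pow (Nat.succ_ne_zero k), zero_div, sub_zero] at key
  rw [← key, intervalIntegral.integral_of_le hv, ← restrict_Ioo_eq_restrict_Ioc,
    ofReal_integral_eq_lintegral_ofReal]
  · exact lintegral_congr fun t => (ENNReal.ofReal_mul (h0 t)).symm
  · have hc : Continuous fun t => accum φ t ^ k / k.factorial := by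
      have := (lipschitzWith_accum hφ h0 h1).continuous
      fun_prop
    have := ((intervalIntegrable_of_mem_Icc hφ h0 h1 0 v).mul_continuousOn hc.continuousOn)
    rw [intervalIntegrable_iff_integrableOn_Ioc_of_le hv] at this
    exact this.mono_set Set.Ioo_subset_Ioc_self
  · refine (ae_restrict_iff' measurableSet_Ioo).2 (ae_of_all _ fun t ht => ?_)
    have := accum_nonneg hφ h0 h1 ht.1.le
    have := h0 t
    simp only [Pi.zero_apply]
    positivity

lemma lintegral_mul_exp_neg_accum_le (t : ℝ) :
    ∫⁻ v in Set.Ioi t, ENNReal.ofReal (φ v) * ENNReal.ofReal (Real.exp (-accum φ v)) ≤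
      ENNReal.ofReal (Real.exp (-accum φ t)) := by
  have hc : Continuous fun t => Real.exp (-accum φ t) := by
    have := (lipschitzWith_accum hφ h0 h1).continuous
    fun_prop
  have hU : Set.Ioi t = ⋃ n : ℕ, Set.Ioc t (t + n) := by
    ext v
    simp only [Set.mem_Ioi, Set.mem_iUnion, Set.mem_Ioc]
    refine ⟨fun h => ?_, fun ⟨_, h⟩ => h.1⟩
    obtain ⟨n, hn⟩ := exists_nat_ge (v - t)
    exact ⟨n, h, by linarith⟩
  have hmono : Monotone fun n : ℕ => Set.Ioc t (t + n) := fun m n h =>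
    Set.Ioc_subset_Ioc_right (by gcongr)
  rw [hU, setLIntegral_iUnion_of_directed _ hmono.directed_le]
  refine iSup_le fun n => ?_
  have hn : t ≤ t + n := by simp
  have key := integral_mul_deriv_comp_accum hφ h0 h1
    (G := fun x : ℝ => -Real.exp (-x)) (by fun_prop) t (t + n)
  have hderiv : ∀ x : ℝ, deriv (fun x : ℝ => -Real.exp (-x)) x = Real.exp (-x) := fun x => by
    have : HasDerivAt (fun x : ℝ => -Real.exp (-x)) (-(Real.exp (-x) * (-1))) x :=
      ((hasDerivAt_neg x).exp).neg
    rw [this.deriv]; ring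
  simp only [hderiv] at key
  calc ∫⁻ v in Set.Ioc t (t + n), ENNReal.ofReal (φ v) * ENNReal.ofReal (Real.exp (-accum φ v))
      = ENNReal.ofReal (∫ v in t..(t + n), φ v * Real.exp (-accum φ v)) := by
        rw [intervalIntegral.integral_of_le hn, ofReal_integral_eq_lintegral_ofReal]
        · exact lintegral_congr fun t => (ENNReal.ofReal_mul (h0 t)).symm
        · have := ((intervalIntegrable_of_mem_Icc hφ h0 h1 t (t + n)).mul_continuousOn
            hc.continuousOn)
          rwa [intervalIntegrable_iff_integrableOn_Ioc_of_le hn] at this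
        · exact ae_of_all _ fun v => mul_nonneg (h0 v) (Real.exp_pos _).le
    _ ≤ _ := by
        rw [key]
        refine ENNReal.ofReal_le_ofReal ?_
        have := Real.exp_pos (-accum φ (t + n))
        linarith

end accum

/-! ### Arrival times of a Poisson process of rate one -/

/-- `T` is the sequence of arrival times of a Poisson process of rate `1`. -/
structure IsPoissonArrivals {Ω : Type*} [MeasurableSpace Ω] (T : ℕ → Ω → ℝ) (μ : Measure Ω) :
    Prop where
  measurable : ∀ i, Measurable (T i)
  iIndep_gap : iIndepFun (fun i ω => gap (fun n => T n ω) i) μ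
  law_gap : ∀ i, HasLaw (fun ω => gap (fun n => T n ω) i) (expMeasure 1) μ

/-- The expectation of `g` at the first arrival after time `t`. -/
noncomputable def nextArrival (g : ℝ → ℝ≥0∞) (t : ℝ) : ℝ≥0∞ :=
  ∫⁻ v in Set.Ioi t, ENNReal.ofReal (Real.exp (t - v)) * g v

lemma lintegral_expMeasure_one_comp_add {g : ℝ → ℝ≥0∞} (hg : Measurable g) (t : ℝ) :
    ∫⁻ y, g (t + y) ∂expMeasure 1 = nextArrival g t := by
  have h1 : ∫⁻ y, g (t + y) ∂expMeasure 1
      = ∫⁻ y, (Set.Ioi 0).indicator (fun y => ENNReal.ofReal (Real.exp (-y)) * g (t + y)) y := by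
    rw [expMeasure, gammaMeasure, lintegral_withDensity_eq_lintegral_mul₀]
    · refine lintegral_congr_ae ?_
      have h0 : ∀ᵐ y : ℝ, y ≠ 0 := by simp [ae_iff, measure_singleton]
      filter_upwards [h0] with y hy
      have := exponentialPDF_eq 1 y
      rw [exponentialPDF, exponentialPDFReal, ← gammaPDF] at this
      rw [Pi.mul_apply, this]
      by_cases h : 0 < y
      · rw [Set.indicator_of_mem (show y ∈ Set.Ioi (0 : ℝ) from h)]; simp [h.le]
      · rw [Set.indicator_of_notMem (show y ∉ Set.Ioi (0 : ℝ) from h)]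
        have : ¬ 0 ≤ y := fun h' => h (lt_of_le_of_ne h' (Ne.symm hy))
        simp [this]
    · exact (measurable_gammaPDFReal 1 1).ennreal_ofReal.aemeasurable
    · fun_prop
  rw [h1, nextArrival, ← lintegral_indicator measurableSet_Ioi,
    ← lintegral_add_left_eq_self ((Set.Ioi t).indicator _) t]
  refine lintegral_congr fun y => ?_
  by_cases h : 0 < y
  · rw [Set.indicator_of_mem (show y ∈ Set.Ioi (0 : ℝ) from h),
      Set.indicator_of_mem (show t + y ∈ Set.Ioi t by simpa using h)]
    simp
  · rw [Set.indicator_of_notMem (show y ∉ Set.Ioi (0 : ℝ) from h),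
      Set.indicator_of_notMem (show t + y ∉ Set.Ioi t by simpa using h)]

lemma sum_gap (t : ℕ → ℝ) (n : ℕ) : ∑ i ∈ Finset.range (n + 1), gap t i = t n := by
  induction n with
  | zero => simp [gap]
  | succ n ih => rw [Finset.sum_range_succ, ih, gap]; ring

section arrivals

variable {Ω : Type*} [MeasurableSpace Ω] {μ : Measure Ω}
  {T : ℕ → Ω → ℝ} (hT : IsPoissonArrivals T μ)

include hT

lemma IsPoissonArrivals.measurable_gap (i : ℕ) :
    Measurable fun ω => gap (fun n => T n ω) i := by
  cases i with
  | zero => exact hT.measurable 0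
  | succ n => exact (hT.measurable (n + 1)).sub (hT.measurable n)

lemma IsPoissonArrivals.lintegral_zero {g : ℝ → ℝ≥0∞} (hg : Measurable g) :
    ∫⁻ ω, g (T 0 ω) ∂μ = nextArrival g 0 := by
  rw [← lintegral_expMeasure_one_comp_add hg]
  simpa [gap] using (hT.law_gap 0).lintegral_comp (f := g) hg.aemeasurable

variable [IsProbabilityMeasure μ]

/-- The Markov property of the arrival times. -/
lemma IsPoissonArrivals.lintegral_succ (n : ℕ) {u : ℕ → ℝ → ℝ≥0∞} (hu : ∀ i, Measurable (u i))
    {g : ℝ → ℝ≥0∞} (hg : Measurable g) :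
    ∫⁻ ω, (∏ i ∈ Finset.range (n + 1), u i (T i ω)) * g (T (n + 1) ω) ∂μ =
      ∫⁻ ω, (∏ i ∈ Finset.range (n + 1), u i (T i ω)) * nextArrival g (T n ω) ∂μ := by
  set E : ℕ → Ω → ℝ := fun i ω => gap (fun n => T n ω) i with hE
  have hEm : ∀ i, Measurable (E i) := hT.measurable_gap
  -- the arrival times up to `n` as functions of the first gaps
  let S : ℕ → (Finset.range (n + 1) → ℝ) → ℝ := fun i e =>
    ∑ j : Finset.range (n + 1), if (j : ℕ) ≤ i then e j else 0
  have hSm : ∀ i, Measurable (S i) := fun i => by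
    refine Finset.measurable_sum _ fun j _ => ?_
    by_cases h : (j : ℕ) ≤ i
    · simpa only [h, if_true] using measurable_pi_apply j
    · simp only [h, if_false]; exact measurable_const
  have hS : ∀ i ∈ Finset.range (n + 1), ∀ ω,
      S i (fun j : Finset.range (n + 1) => E j ω) = T i ω := fun i hi ω => by
    rw [← sum_gap (fun n => T n ω) i]
    simp only [S]
    rw [Finset.sum_coe_sort (Finset.range (n + 1)) (fun j => if j ≤ i then E j ω else 0),
      ← Finset.sum_filter]
    refine Finset.sum_congr ?_ fun _ _ => rfl
    ext j
    simp only [Finset.mem_filter, Finset.mem_range] at hi ⊢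
    omega
  have hind : IndepFun (fun ω (j : Finset.range (n + 1)) => E j ω) (E (n + 1)) μ := by
    have := hT.iIndep_gap.indepFun_finset (Finset.range (n + 1)) {n + 1} (by simp) hEm
    exact this.comp (φ := id) (ψ := fun y : (({n + 1} : Finset ℕ) → ℝ) => y ⟨n + 1, by simp⟩)
      measurable_id (measurable_pi_apply _)
  have hXm : Measurable fun ω (j : Finset.range (n + 1)) => E j ω :=
    measurable_pi_lambda _ fun j => hEm j
  have hmap := hind.map_prod_eq_prod_map_map hXm.aemeasurable (hEm _).aemeasurable
  rw [(hT.law_gap (n + 1)).map_eq] at hmap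
  have : IsProbabilityMeasure (expMeasure 1) := isProbabilityMeasure_expMeasure one_pos
  have hHm : Measurable fun p : (Finset.range (n + 1) → ℝ) × ℝ =>
      (∏ i ∈ Finset.range (n + 1), u i (S i p.1)) * g (S n p.1 + p.2) := by
    refine (Finset.measurable_prod _ fun i _ => ?_).mul ?_
    · exact (hu i).comp ((hSm i).comp measurable_fst)
    · exact hg.comp (((hSm n).comp measurable_fst).add measurable_snd)
  calc ∫⁻ ω, (∏ i ∈ Finset.range (n + 1), u i (T i ω)) * g (T (n + 1) ω) ∂μ
      = ∫⁻ ω, (fun p : (Finset.range (n + 1) → ℝ) × ℝ =>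
          (∏ i ∈ Finset.range (n + 1), u i (S i p.1)) * g (S n p.1 + p.2))
          (fun j : Finset.range (n + 1) => E j ω, E (n + 1) ω) ∂μ := by
        refine lintegral_congr fun ω => ?_
        have hp : ∏ i ∈ Finset.range (n + 1), u i (S i fun j : Finset.range (n + 1) => E j ω) =
            ∏ i ∈ Finset.range (n + 1), u i (T i ω) :=
          Finset.prod_congr rfl fun i hi => by rw [hS i hi ω]
        simp only [hp, hS n (by simp) ω]
        simp [hE, gap]
    _ = ∫⁻ p, (∏ i ∈ Finset.range (n + 1), u i (S i p.1)) * g (S n p.1 + p.2)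
          ∂((μ.map fun ω (j : Finset.range (n + 1)) => E j ω).prod (expMeasure 1)) := by
        rw [← hmap, lintegral_map hHm (hXm.prodMk (hEm _))]
    _ = ∫⁻ e, (∏ i ∈ Finset.range (n + 1), u i (S i e)) * nextArrival g (S n e)
          ∂(μ.map fun ω (j : Finset.range (n + 1)) => E j ω) := by
        rw [lintegral_prod _ hHm.aemeasurable]
        refine lintegral_congr fun e => ?_
        simp only
        rw [lintegral_const_mul _ (by fun_prop), lintegral_expMeasure_one_comp_add hg]
    _ = _ := by
        rw [lintegral_map _ hXm]
        · refine lintegral_congr fun ω => ?_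
          have hp : ∏ i ∈ Finset.range (n + 1), u i (S i fun j : Finset.range (n + 1) => E j ω) =
              ∏ i ∈ Finset.range (n + 1), u i (T i ω) :=
            Finset.prod_congr rfl fun i hi => by rw [hS i hi ω]
          simp only [hp, hS n (by simp) ω]
        · refine (Finset.measurable_prod _ fun i _ => (hu i).comp (hSm i)).mul ?_
          have : Measurable fun t => ∫⁻ y, g (t + y) ∂expMeasure 1 :=
            Measurable.lintegral_prod_right' (f := fun p : ℝ × ℝ => g (p.1 + p.2)) (by fun_prop)
          simp only [lintegral_expMeasure_one_comp_add hg] at this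
          exact this.comp (hSm n)

lemma IsPoissonArrivals.lintegral_exp_neg (n : ℕ) :
    ∫⁻ ω, ENNReal.ofReal (Real.exp (-T n ω)) ∂μ = ENNReal.ofReal ((1 / 2) ^ (n + 1)) := by
  have hnext : ∀ t, nextArrival (fun v => ENNReal.ofReal (Real.exp (-v))) t
      = ENNReal.ofReal (1 / 2) * ENNReal.ofReal (Real.exp (-t)) := fun t => by
    have h2 : ∀ v : ℝ, ENNReal.ofReal (Real.exp (t - v)) * ENNReal.ofReal (Real.exp (-v)) =
        ENNReal.ofReal (Real.exp t * Real.exp (-2 * v)) := fun v => by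
      rw [← ENNReal.ofReal_mul (Real.exp_pos _).le, ← Real.exp_add, ← Real.exp_add]
      congr 2; ring
    rw [nextArrival]
    simp only [h2]
    rw [← ofReal_integral_eq_lintegral_ofReal, ← ENNReal.ofReal_mul (by norm_num)]
    · congr 1
      rw [integral_const_mul, integral_exp_mul_Ioi (by norm_num) t]
      have : Real.exp (-2 * t) = Real.exp (-t) * Real.exp (-t) := by
        rw [← Real.exp_add]; congr 1; ring
      rw [this, Real.exp_neg]
      field_simp
    · exact (integrableOn_exp_mul_Ioi (by norm_num) t).const_mul _
    · exact ae_of_all _ fun v => by positivity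
  have hm : Measurable fun v : ℝ => ENNReal.ofReal (Real.exp (-v)) := by fun_prop
  induction n with
  | zero =>
    rw [hT.lintegral_zero (g := fun v => ENNReal.ofReal (Real.exp (-v))) hm, hnext]
    simp
  | succ n ih =>
    have := hT.lintegral_succ n (u := fun _ _ => 1) (fun _ => measurable_const) hm
    simp only [Finset.prod_const_one, one_mul, hnext] at this
    have hTn := hT.measurable n
    rw [this, lintegral_const_mul _ (by fun_prop), ih,
      ← ENNReal.ofReal_mul (by norm_num)]
    congr 1; ring

variable {φ : ℝ → ℝ} (hφ : Measurable φ) (h0 : ∀ t, 0 ≤ φ t) (h1 : ∀ t, φ t ≤ 1)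

include hφ h0 h1

/-- The law of the `k`-th arrival time, weighted by the product of `φ` over the earlier
arrivals, has density `e^{-t} (∫₀ᵗ φ)ᵏ / k!`. -/
lemma IsPoissonArrivals.lintegral_prod_mul (k : ℕ) {g : ℝ → ℝ≥0∞} (hg : Measurable g) :
    ∫⁻ ω, (∏ i ∈ Finset.range k, ENNReal.ofReal (φ (T i ω))) * g (T k ω) ∂μ =
      ∫⁻ t in Set.Ioi 0, ENNReal.ofReal (Real.exp (-t)) *
        ENNReal.ofReal (accum φ t ^ k / k.factorial) * g t := by
  have hAm := measurable_accum hφ h0 h1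
  induction k generalizing g with
  | zero => simp [hT.lintegral_zero hg, nextArrival]
  | succ k ih =>
    have hnm : Measurable (nextArrival g) := by
      have : Measurable fun t => ∫⁻ y, g (t + y) ∂expMeasure 1 := by
        have : IsProbabilityMeasure (expMeasure 1) := isProbabilityMeasure_expMeasure one_pos
        exact Measurable.lintegral_prod_right' (f := fun p : ℝ × ℝ => g (p.1 + p.2))
          (by fun_prop)
      simpa only [lintegral_expMeasure_one_comp_add hg] using this
    rw [hT.lintegral_succ k (u := fun _ t => ENNReal.ofReal (φ t)) (fun _ => by fun_prop) hg]
    simp only [Finset.prod_range_succ, mul_assoc]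
    have := ih (g := fun t => ENNReal.ofReal (φ t) * nextArrival g t) (by fun_prop)
    rw [this]
    -- both sides are integrals over the region `0 < t < v`
    let F : ℝ → ℝ → ℝ≥0∞ := fun t v => ENNReal.ofReal (Real.exp (-v)) * g v *
      (ENNReal.ofReal (φ t) * ENNReal.ofReal (accum φ t ^ k / k.factorial))
    have hFm : Measurable fun p : ℝ × ℝ => F p.1 p.2 := by fun_prop
    have hind : MeasurableSet {p : ℝ × ℝ | p.1 < p.2} := measurableSet_lt measurable_fst
      measurable_snd
    calc _ = ∫⁻ t in Set.Ioi 0, ∫⁻ v in Set.Ioi 0, {p : ℝ × ℝ | p.1 < p.2}.indicator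
          (fun p => F p.1 p.2) (t, v) := by
          refine setLIntegral_congr_fun measurableSet_Ioi fun t ht => ?_
          have hsub : Set.Ioi t ⊆ Set.Ioi (0 : ℝ) := Set.Ioi_subset_Ioi (le_of_lt ht)
          have : ∀ v, {p : ℝ × ℝ | p.1 < p.2}.indicator (fun p => F p.1 p.2) (t, v) =
              (Set.Ioi t).indicator (F t) v := fun v => by
            simp [Set.indicator]
          simp only [this]
          rw [lintegral_indicator measurableSet_Ioi, Measure.restrict_restrict measurableSet_Ioi,
            Set.inter_eq_left.2 hsub, nextArrival]
          rw [← lintegral_const_mul _ (by fun_prop), ← lintegral_const_mul _ (by fun_prop)]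
          refine lintegral_congr fun v => ?_
          have : Real.exp (-v) = Real.exp (-t) * Real.exp (t - v) := by
            rw [← Real.exp_add]; congr 1; ring
          simp only [F]
          rw [this, ENNReal.ofReal_mul (Real.exp_pos _).le]
          ring
      _ = ∫⁻ v in Set.Ioi 0, ∫⁻ t in Set.Ioi 0, {p : ℝ × ℝ | p.1 < p.2}.indicator
          (fun p => F p.1 p.2) (t, v) := by
          rw [lintegral_lintegral_swap]
          exact (hFm.indicator hind).aemeasurable
      _ = _ := by
          refine setLIntegral_congr_fun measurableSet_Ioi fun v hv => ?_
          have : ∀ t, {p : ℝ × ℝ | p.1 < p.2}.indicator (fun p => F p.1 p.2) (t, v) =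
              (Set.Iio v).indicator (fun t => F t v) t := fun t => by
            simp [Set.indicator]
          simp only [this]
          rw [lintegral_indicator measurableSet_Iio, Measure.restrict_restrict measurableSet_Iio,
            Set.inter_comm, Set.Ioi_inter_Iio, lintegral_const_mul _ (by fun_prop),
            lintegral_mul_accum_pow hφ h0 h1 k (le_of_lt hv)]
          ring

/-- The expectation of `Ψ` at the `k`-th arrival times the product of `φ` over all the other
arrivals, up to a cut-off at time `R`. The factor `exp (-(R - accum φ R))` accounts for the
arrivals after the `k`-th, because `∏_{i ≤ n} φ(Tᵢ) · exp (Tₙ - accum φ Tₙ)` is a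
supermartingale. -/
lemma IsPoissonArrivals.lintegral_mul_prod_le (k n : ℕ) (hkn : k ≤ n) {Ψ : ℝ → ℝ≥0∞}
    (hΨ : Measurable Ψ) {B : ℝ≥0∞} (hB : ∀ t, Ψ t ≤ B) (R : ℝ) :
    ∫⁻ ω, ∏ i ∈ Finset.range (n + 1),
        (if i = k then Ψ (T i ω) else ENNReal.ofReal (φ (T i ω))) ∂μ ≤
      ENNReal.ofReal (Real.exp (-(R - accum φ R))) *
        (∫⁻ t in Set.Ioi 0, Ψ t * ENNReal.ofReal
          (Real.exp (-accum φ t) * accum φ t ^ k / k.factorial)) +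
      B * ENNReal.ofReal (Real.exp R * (1 / 2) ^ (n + 1)) := by
  have hAm := measurable_accum hφ h0 h1
  let u : ℕ → ℝ → ℝ≥0∞ := fun i t => if i = k then Ψ t else ENNReal.ofReal (φ t)
  have hu : ∀ i, Measurable (u i) := fun i => by
    by_cases h : i = k
    · simpa only [u, h, if_true] using hΨ
    · simp only [u, h, if_false]; fun_prop
  let γ : ℝ → ℝ≥0∞ := fun t => ENNReal.ofReal (Real.exp (t - accum φ t))
  have hγ : Measurable γ := by fun_prop
  -- the supermartingale property
  have hsuper : ∀ m, k ≤ m →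
      ∫⁻ ω, (∏ i ∈ Finset.range (m + 1), u i (T i ω)) * γ (T m ω) ∂μ ≤
      ∫⁻ ω, (∏ i ∈ Finset.range (k + 1), u i (T i ω)) * γ (T k ω) ∂μ := by
    intro m hm
    induction m, hm using Nat.le_induction with
    | base => exact le_rfl
    | succ m hm ih =>
      refine le_trans ?_ ih
      have hne : m + 1 ≠ k := by omega
      simp only [Finset.prod_range_succ _ (m + 1), mul_assoc]
      have : ∀ ω, u (m + 1) (T (m + 1) ω) * γ (T (m + 1) ω) =
          (fun t => ENNReal.ofReal (φ t) * γ t) (T (m + 1) ω) := fun ω => by simp [u, hne]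
      simp_rw [this]
      rw [hT.lintegral_succ m hu (g := fun t => ENNReal.ofReal (φ t) * γ t) (by fun_prop)]
      refine lintegral_mono fun ω => mul_le_mul_right ?_ _
      rw [nextArrival]
      calc _ = ∫⁻ v in Set.Ioi (T m ω), ENNReal.ofReal (Real.exp (T m ω)) *
            (ENNReal.ofReal (φ v) * ENNReal.ofReal (Real.exp (-accum φ v))) := by
            refine lintegral_congr fun v => ?_
            have : Real.exp (T m ω) * Real.exp (-accum φ v) =
                Real.exp (T m ω - v) * Real.exp (v - accum φ v) := by
              rw [← Real.exp_add, ← Real.exp_add]; congr 1; ring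
            rw [mul_left_comm, ← ENNReal.ofReal_mul (Real.exp_pos _).le, ← this,
              ENNReal.ofReal_mul (Real.exp_pos _).le]
            ring
        _ = ENNReal.ofReal (Real.exp (T m ω)) * ∫⁻ v in Set.Ioi (T m ω),
            (ENNReal.ofReal (φ v) * ENNReal.ofReal (Real.exp (-accum φ v))) :=
            lintegral_const_mul _ (by fun_prop)
        _ ≤ ENNReal.ofReal (Real.exp (T m ω)) * ENNReal.ofReal (Real.exp (-accum φ (T m ω))) :=
            mul_le_mul_right (lintegral_mul_exp_neg_accum_le hφ h0 h1 _) _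
        _ = _ := by
            rw [← ENNReal.ofReal_mul (Real.exp_pos _).le, ← Real.exp_add, ← sub_eq_add_neg]
  have hbase : ∫⁻ ω, (∏ i ∈ Finset.range (k + 1), u i (T i ω)) * γ (T k ω) ∂μ =
      ∫⁻ t in Set.Ioi 0, Ψ t * ENNReal.ofReal
          (Real.exp (-accum φ t) * accum φ t ^ k / k.factorial) := by
    have := hT.lintegral_prod_mul hφ h0 h1 k (g := fun t => Ψ t * γ t) (by fun_prop)
    convert this using 1
    · refine lintegral_congr fun ω => ?_
      rw [Finset.prod_range_succ, mul_assoc]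
      congr 1
      · refine Finset.prod_congr rfl fun i hi => ?_
        have : i ≠ k := (Finset.mem_range.1 hi).ne
        simp [u, this]
      · simp [u]
    · refine lintegral_congr fun t => ?_
      have : Real.exp (-accum φ t) * accum φ t ^ k / k.factorial =
          Real.exp (-t) * Real.exp (t - accum φ t) * (accum φ t ^ k / k.factorial) := by
        rw [← Real.exp_add, mul_div_assoc]; congr 2; ring
      rw [this, ENNReal.ofReal_mul (by positivity), ENNReal.ofReal_mul (by positivity)]
      ring
  -- the constant `1` is dominated by the multiplier after time `R`
  have hone : ∀ t, 1 ≤ ENNReal.ofReal (Real.exp (-(R - accum φ R))) * γ t +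
      ENNReal.ofReal (Real.exp R) * ENNReal.ofReal (Real.exp (-t)) := fun t => by
    simp only [γ]
    rw [← ENNReal.ofReal_mul (Real.exp_pos _).le, ← ENNReal.ofReal_mul (Real.exp_pos _).le,
      ← Real.exp_add, ← Real.exp_add]
    rcases le_total R t with h | h
    · refine le_add_right ?_
      rw [← ENNReal.ofReal_one]
      refine ENNReal.ofReal_le_ofReal (Real.one_le_exp ?_)
      have := accum_sub_le hφ h0 h1 h
      linarith
    · refine le_add_left ?_
      rw [← ENNReal.ofReal_one]
      exact ENNReal.ofReal_le_ofReal (Real.one_le_exp (by linarith))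
  have hprod : ∀ ω, ∏ i ∈ Finset.range (n + 1), u i (T i ω) ≤ B := fun ω => by
    rw [← Finset.mul_prod_erase _ _ (Finset.mem_range.2 (Nat.lt_succ_of_le hkn))]
    calc _ ≤ B * 1 := by
          refine mul_le_mul' (by simpa [u] using hB _) (Finset.prod_le_one' fun i hi => ?_)
          have : i ≠ k := Finset.ne_of_mem_erase hi
          simpa [u, this] using h1 _
      _ = B := mul_one B
  have hUm : Measurable fun ω => ∏ i ∈ Finset.range (n + 1), u i (T i ω) :=
    Finset.measurable_prod _ fun i _ => (hu i).comp (hT.measurable i)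
  have hTn := hT.measurable n
  calc _ = ∫⁻ ω, ∏ i ∈ Finset.range (n + 1), u i (T i ω) ∂μ := rfl
    _ ≤ ∫⁻ ω, (ENNReal.ofReal (Real.exp (-(R - accum φ R))) *
          ((∏ i ∈ Finset.range (n + 1), u i (T i ω)) * γ (T n ω)) +
          B * (ENNReal.ofReal (Real.exp R) * ENNReal.ofReal (Real.exp (-T n ω)))) ∂μ := by
        refine lintegral_mono fun ω => ?_
        calc _ = (∏ i ∈ Finset.range (n + 1), u i (T i ω)) * 1 := (mul_one _).symm
          _ ≤ (∏ i ∈ Finset.range (n + 1), u i (T i ω)) *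
              (ENNReal.ofReal (Real.exp (-(R - accum φ R))) * γ (T n ω) +
              ENNReal.ofReal (Real.exp R) * ENNReal.ofReal (Real.exp (-T n ω))) :=
              mul_le_mul_right (hone _) _
          _ ≤ _ := by
              rw [mul_add]
              refine add_le_add (le_of_eq (by ring)) (mul_le_mul_left (hprod ω) _)
    _ = _ := by
        rw [lintegral_add_left (by fun_prop), lintegral_const_mul _ (by fun_prop),
          lintegral_const_mul _ (by fun_prop), lintegral_const_mul _ (by fun_prop)]
    _ ≤ _ := by
        rw [hT.lintegral_exp_neg, ← ENNReal.ofReal_mul (Real.exp_pos _).le]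
        exact add_le_add (mul_le_mul_right ((hsuper n hkn).trans_eq hbase) _) le_rfl

end arrivals

/-! ### The marked Poisson process -/

/-- Jensen's inequality `E log (N + 1) ≤ log (1 + a)` for a Poisson variable `N` of mean `a`. -/
lemma tsum_log_mul_poisson_le {a : ℝ} (ha : 0 ≤ a) :
    ∑' k : ℕ, ENNReal.ofReal (Real.log (k + 1)) *
      ENNReal.ofReal (Real.exp (-a) * a ^ k / k.factorial) ≤
      ENNReal.ofReal (Real.log (1 + a)) := by
  set p : ℕ → ℝ := fun k => Real.exp (-a) * a ^ k / k.factorial with hp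
  have hp0 : ∀ k, 0 ≤ p k := fun k => by positivity
  have hs0 : HasSum p 1 := by
    have := (NormedSpace.expSeries_div_hasSum_exp a).mul_left (Real.exp (-a))
    rw [← Real.exp_eq_exp_ℝ, ← Real.exp_add, neg_add_cancel, Real.exp_zero] at this
    simpa only [hp, mul_div_assoc] using this
  have hs1 : HasSum (fun k : ℕ => (k : ℝ) * p k) a := by
    rw [← hasSum_nat_add_iff' 1]
    have := hs0.mul_left a
    rw [mul_one] at this
    have e : (fun k : ℕ => ((k + 1 : ℕ) : ℝ) * p (k + 1)) = fun k => a * p k := by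
      funext k
      simp only [hp, Nat.factorial_succ, pow_succ]
      push_cast
      field_simp
    rw [e]
    simpa using this
  have h1a : 0 < 1 + a := by linarith
  -- the tangent line of the logarithm at `1 + a`
  have htan : ∀ k : ℕ, Real.log (k + 1) ≤ Real.log (1 + a) + (k - a) / (1 + a) := fun k => by
    have hk : (0 : ℝ) < k + 1 := by positivity
    have := Real.log_le_sub_one_of_pos (div_pos hk h1a)
    rw [Real.log_div hk.ne' h1a.ne'] at this
    have h2 : ((k : ℝ) + 1) / (1 + a) - 1 = (k - a) / (1 + a) := by field_simp; ring
    linarith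
  have hlog : ∀ k : ℕ, 0 ≤ Real.log ((k : ℝ) + 1) := fun k =>
    Real.log_nonneg (by have : (0 : ℝ) ≤ k := k.cast_nonneg; linarith)
  have hs2 : HasSum (fun k : ℕ => (Real.log (1 + a) + (k - a) / (1 + a)) * p k)
      (Real.log (1 + a)) := by
    have := (hs0.mul_left (Real.log (1 + a) - a / (1 + a))).add (hs1.mul_left (1 / (1 + a)))
    have e : (fun k : ℕ => (Real.log (1 + a) + (k - a) / (1 + a)) * p k) = fun k : ℕ =>
        (Real.log (1 + a) - a / (1 + a)) * p k + 1 / (1 + a) * ((k : ℝ) * p k) := by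
      funext k; ring
    have e' : (Real.log (1 + a) - a / (1 + a)) * 1 + 1 / (1 + a) * a = Real.log (1 + a) := by
      ring
    rwa [e', ← e] at this
  rw [← hs2.tsum_eq, ENNReal.ofReal_tsum_of_nonneg
    (fun k => mul_nonneg ((hlog k).trans (htan k)) (hp0 k)) hs2.summable]
  refine ENNReal.tsum_le_tsum fun k => ?_
  rw [← ENNReal.ofReal_mul (hlog k)]
  exact ENNReal.ofReal_le_ofReal (mul_le_mul_of_nonneg_right (htan k) (hp0 k))

/-- The substitution `t = u f` behind the passage from arrival times to tilted ones. -/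
lemma setLIntegral_Ioi_comp_div {G : ℝ → ℝ≥0∞ → ℝ≥0∞} (hG : Measurable (Function.uncurry G))
    (hG0 : ∀ t, G t ∞ = 0) {c : ℝ≥0∞} (hc : c ≠ ∞) :
    ∫⁻ t in Set.Ioi 0, G t (ENNReal.ofReal t / c) =
      c * ∫⁻ u in Set.Ioi 0, G (u * c.toReal) (ENNReal.ofReal u) := by
  rcases eq_or_ne c 0 with rfl | hc0
  · rw [zero_mul, setLIntegral_congr_fun (g := fun _ => 0) measurableSet_Ioi]
    · simp
    · intro t ht
      simp only
      rw [ENNReal.div_zero (by simpa using ht), hG0]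
  · have hr : 0 < c.toReal := ENNReal.toReal_pos hc0 hc
    have hpre : (fun u : ℝ => c.toReal * u) ⁻¹' Set.Ioi 0 = Set.Ioi 0 := by
      ext u; simp [hr]
    have hmap := Real.smul_map_volume_mul_left hr.ne'
    rw [abs_of_pos hr, ENNReal.ofReal_toReal hc] at hmap
    have hGm : Measurable fun t => G t (ENNReal.ofReal t / c) :=
      hG.comp (f := fun t : ℝ => (t, ENNReal.ofReal t / c)) (by fun_prop)
    have hscale : ∫⁻ t in Set.Ioi 0, G t (ENNReal.ofReal t / c) =
        c * ∫⁻ u in Set.Ioi 0, G (c.toReal * u) (ENNReal.ofReal (c.toReal * u) / c) := by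
      conv_lhs => rw [← hmap]
      rw [Measure.restrict_smul, lintegral_smul_measure,
        setLIntegral_map measurableSet_Ioi hGm (by fun_prop), hpre, smul_eq_mul]
    rw [hscale]
    congr 1
    refine setLIntegral_congr_fun measurableSet_Ioi fun u hu => ?_
    congr 1
    · ring
    · rw [ENNReal.ofReal_mul hr.le, ENNReal.ofReal_toReal hc, mul_comm,
        ENNReal.mul_div_cancel_right hc0 hc]

section marked

variable {𝒵 Ω : Type*} [MeasurableSpace 𝒵] [MeasurableSpace Ω] {μ : Measure Ω}

/-- `(T, Z)` is a Poisson process of rate `1` with independent marks of law `Q`. -/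
structure IsMarkedPoisson (T : ℕ → Ω → ℝ) (Z : ℕ → Ω → 𝒵) (Q : Measure 𝒵) (μ : Measure Ω) :
    Prop extends IsPoissonArrivals T μ where
  measurable_Z : ∀ i, Measurable (Z i)
  iIndep_Z : iIndepFun Z μ
  law_Z : ∀ i, HasLaw (Z i) Q μ
  indep_T_Z : IndepFun (fun ω i => T i ω) (fun ω i => Z i ω) μ

variable [IsProbabilityMeasure μ] {T : ℕ → Ω → ℝ} {Z : ℕ → Ω → 𝒵} {Q : Measure 𝒵}
  (h : IsMarkedPoisson T Z Q μ)

include h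

/-- The marks can be integrated out one by one. -/
lemma IsMarkedPoisson.lintegral_prod (n : ℕ) {g : ℕ → ℝ → 𝒵 → ℝ≥0∞}
    (hg : ∀ i, Measurable (Function.uncurry (g i))) :
    ∫⁻ ω, ∏ i ∈ Finset.range n, g i (T i ω) (Z i ω) ∂μ =
      ∫⁻ ω, ∏ i ∈ Finset.range n, ∫⁻ z, g i (T i ω) z ∂Q ∂μ := by
  have hTm : Measurable fun ω i => T i ω := measurable_pi_lambda _ h.measurable
  have hZm : Measurable fun ω i => Z i ω := measurable_pi_lambda _ h.measurable_Z
  have hmap := h.indep_T_Z.map_prod_eq_prod_map_map hTm.aemeasurable hZm.aemeasurable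
  have : IsProbabilityMeasure (μ.map fun ω i => Z i ω) :=
    Measure.isProbabilityMeasure_map hZm.aemeasurable
  have : IsProbabilityMeasure (μ.map fun ω i => T i ω) :=
    Measure.isProbabilityMeasure_map hTm.aemeasurable
  have hFm : Measurable fun p : (ℕ → ℝ) × (ℕ → 𝒵) => ∏ i ∈ Finset.range n, g i (p.1 i) (p.2 i) :=
    Finset.measurable_prod _ fun i _ => (hg i).comp
      (f := fun p : (ℕ → ℝ) × (ℕ → 𝒵) => (p.1 i, p.2 i)) (by fun_prop)
  have hQ : IsProbabilityMeasure Q := (h.law_Z 0).isProbabilityMeasure_iff.1 inferInstance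
  calc ∫⁻ ω, ∏ i ∈ Finset.range n, g i (T i ω) (Z i ω) ∂μ
      = ∫⁻ p, ∏ i ∈ Finset.range n, g i (p.1 i) (p.2 i)
          ∂((μ.map fun ω i => T i ω).prod (μ.map fun ω i => Z i ω)) := by
        rw [← hmap, lintegral_map hFm (hTm.prodMk hZm)]
    _ = ∫⁻ t, ∏ i ∈ Finset.range n, ∫⁻ z, g i (t i) z ∂Q ∂(μ.map fun ω i => T i ω) := by
        rw [MeasureTheory.lintegral_prod _ hFm.aemeasurable]
        refine lintegral_congr fun t => ?_
        have hgt : ∀ i, Measurable (g i (t i)) := fun i =>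
          (hg i).comp (f := fun z => (t i, z)) (by fun_prop)
        simp only
        have hm : Measurable fun y : ℕ → 𝒵 => ∏ i ∈ Finset.range n, g i (t i) (y i) :=
          Finset.measurable_prod _ fun i _ => (hgt i).comp (measurable_pi_apply i)
        rw [lintegral_map hm hZm]
        rw [lintegral_prod_eq_prod_lintegral_of_indepFun (Finset.range n)
          (fun i ω => g i (t i) (Z i ω)) (h.iIndep_Z.comp _ hgt)
          (fun i => (hgt i).comp (h.measurable_Z i))]
        exact Finset.prod_congr rfl fun i _ => (h.law_Z i).lintegral_comp (hgt i).aemeasurable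
    _ = _ := by
        rw [lintegral_map (Finset.measurable_prod _ fun i _ => ?_) hTm]
        exact (Measurable.lintegral_prod_right' (hg i)).comp (measurable_pi_apply i)

/-- The expectation of `ψ` at the `k`-th tilted arrival times the product of `φ` over all other
tilted arrivals, weighted by `log (k + 1)` and summed over `k`, is at most what it would be if the
other points were independent of the `k`-th one and `log (k + 1)` were replaced by
`log (1 + T_k)`. Here `exp (-H)` bounds the expected product of `φ` over all tilted arrivals. -/
lemma IsMarkedPoisson.tsum_log_mul_lintegral_le {f : 𝒵 → ℝ≥0∞} (hf : Measurable f)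
    (hf1 : ∫⁻ z, f z ∂Q = 1) {φ ψ : ℝ≥0∞ → ℝ≥0∞} (hφ : Measurable φ) (hψ : Measurable ψ)
    (hφ1 : ∀ x, φ x ≤ 1) (hφtop : φ ∞ = 1) (hψtop : ψ ∞ = 0) {B : ℝ≥0∞} (hB : B ≠ ∞)
    (hψB : ∀ x, ψ x ≤ B) {H : ℝ}
    (hH : ENNReal.ofReal H ≤ ∫⁻ u in Set.Ioi 0, (1 - φ (ENNReal.ofReal u))) :
    ∑' k : ℕ, ENNReal.ofReal (Real.log (k + 1)) *
      ∫⁻ ω, ψ (tilted f (fun i => T i ω) (fun i => Z i ω) k) * ⨅ n,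
        ∏ i ∈ (Finset.range n).erase k, φ (tilted f (fun i => T i ω) (fun i => Z i ω) i) ∂μ ≤
    ENNReal.ofReal (Real.exp (-H)) * ∫⁻ z, f z * (∫⁻ u in Set.Ioi 0,
      ψ (ENNReal.ofReal u) * ENNReal.ofReal (Real.log (1 + u * (f z).toReal))) ∂Q := by
  have hQ : IsProbabilityMeasure Q := (h.law_Z 0).isProbabilityMeasure_iff.1 inferInstance
  let Φ : ℝ → ℝ≥0∞ := fun t => ∫⁻ z, φ (ENNReal.ofReal t / f z) ∂Q
  let Ψ : ℝ → ℝ≥0∞ := fun t => ∫⁻ z, ψ (ENNReal.ofReal t / f z) ∂Q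
  have hΦm : Measurable Φ := Measurable.lintegral_prod_right'
    (f := fun p : ℝ × 𝒵 => φ (ENNReal.ofReal p.1 / f p.2)) (by fun_prop)
  have hΨm : Measurable Ψ := Measurable.lintegral_prod_right'
    (f := fun p : ℝ × 𝒵 => ψ (ENNReal.ofReal p.1 / f p.2)) (by fun_prop)
  have hΦ1 : ∀ t, Φ t ≤ 1 := fun t =>
    (lintegral_mono fun z => hφ1 _).trans_eq (by simp)
  have hΨB : ∀ t, Ψ t ≤ B := fun t =>
    (lintegral_mono fun z => hψB _).trans_eq (by simp)
  let φ' : ℝ → ℝ := fun t => (Φ t).toReal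
  have hφ'm : Measurable φ' := hΦm.ennreal_toReal
  have h0 : ∀ t, 0 ≤ φ' t := fun t => ENNReal.toReal_nonneg
  have h1 : ∀ t, φ' t ≤ 1 := fun t =>
    ENNReal.toReal_le_of_le_ofReal one_pos.le (by simpa using hΦ1 t)
  have hofReal : ∀ t, ENNReal.ofReal (φ' t) = Φ t := fun t =>
    ENNReal.ofReal_toReal ((hΦ1 t).trans_lt ENNReal.one_lt_top).ne
  have hftop : ∀ᵐ z ∂Q, f z ≠ ∞ := by
    filter_upwards [ae_lt_top hf (by simp [hf1])] with z hz using hz.ne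
  have hAm := measurable_accum hφ'm h0 h1
  -- one term of the sum, with a cut-off at time `R`
  have hterm : ∀ (k : ℕ) (R : ℝ),
      ∫⁻ ω, ψ (tilted f (fun i => T i ω) (fun i => Z i ω) k) * ⨅ n,
        ∏ i ∈ (Finset.range n).erase k, φ (tilted f (fun i => T i ω) (fun i => Z i ω) i) ∂μ ≤
      ENNReal.ofReal (Real.exp (-(R - accum φ' R))) * ∫⁻ t in Set.Ioi 0, Ψ t *
        ENNReal.ofReal (Real.exp (-accum φ' t) * accum φ' t ^ k / k.factorial) := by
    intro k R
    have hn : ∀ n, k ≤ n →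
        ∫⁻ ω, ψ (tilted f (fun i => T i ω) (fun i => Z i ω) k) * ⨅ n,
          ∏ i ∈ (Finset.range n).erase k, φ (tilted f (fun i => T i ω) (fun i => Z i ω) i) ∂μ ≤
        ENNReal.ofReal (Real.exp (-(R - accum φ' R))) * (∫⁻ t in Set.Ioi 0, Ψ t *
          ENNReal.ofReal (Real.exp (-accum φ' t) * accum φ' t ^ k / k.factorial)) +
        B * ENNReal.ofReal (Real.exp R * (1 / 2) ^ (n + 1)) := by
      intro n hkn
      refine le_trans ?_ (h.lintegral_mul_prod_le hφ'm h0 h1 k n hkn hΨm hΨB R)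
      have hg := h.lintegral_prod (n + 1) (g := fun i t z =>
        if i = k then ψ (ENNReal.ofReal t / f z) else φ (ENNReal.ofReal t / f z)) (fun i => by
          by_cases hi : i = k
          · simp only [hi, if_true]; unfold Function.uncurry; fun_prop
          · simp only [hi, if_false]; unfold Function.uncurry; fun_prop)
      have : ∀ ω, ∏ i ∈ Finset.range (n + 1),
          (if i = k then Ψ (T i ω) else ENNReal.ofReal (φ' (T i ω))) =
          ∏ i ∈ Finset.range (n + 1), ∫⁻ z, (if i = k then ψ (ENNReal.ofReal (T i ω) / f z)
            else φ (ENNReal.ofReal (T i ω) / f z)) ∂Q := fun ω => by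
        refine Finset.prod_congr rfl fun i _ => ?_
        by_cases hi : i = k
        · simp [hi, Ψ]
        · simp [hi, hofReal, Φ]
      simp only [this]
      rw [← hg]
      refine lintegral_mono fun ω => ?_
      rw [← Finset.mul_prod_erase _ _ (Finset.mem_range.2 (Nat.lt_succ_of_le hkn))]
      refine mul_le_mul' (by simp [tilted]) ((iInf_le _ (n + 1)).trans (le_of_eq ?_))
      refine Finset.prod_congr rfl fun i hi => ?_
      simp [tilted, Finset.ne_of_mem_erase hi]
    have hlim : Filter.Tendsto (fun n : ℕ =>
        ENNReal.ofReal (Real.exp (-(R - accum φ' R))) * (∫⁻ t in Set.Ioi 0, Ψ t *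
          ENNReal.ofReal (Real.exp (-accum φ' t) * accum φ' t ^ k / k.factorial)) +
        B * ENNReal.ofReal (Real.exp R * (1 / 2) ^ (n + 1))) Filter.atTop
        (nhds (ENNReal.ofReal (Real.exp (-(R - accum φ' R))) * (∫⁻ t in Set.Ioi 0, Ψ t *
          ENNReal.ofReal (Real.exp (-accum φ' t) * accum φ' t ^ k / k.factorial)) +
          B * ENNReal.ofReal (Real.exp R * 0))) := by
      refine Filter.Tendsto.const_add _ (ENNReal.Tendsto.const_mul ?_ (Or.inr hB))
      refine ENNReal.tendsto_ofReal (Filter.Tendsto.const_mul _ ?_)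
      exact (tendsto_pow_atTop_nhds_zero_of_lt_one (by norm_num) (by norm_num)).comp
        (Filter.tendsto_add_atTop_nat 1)
    simp only [mul_zero, ENNReal.ofReal_zero, add_zero] at hlim
    refine ge_of_tendsto hlim ?_
    filter_upwards [Filter.eventually_ge_atTop k] with n using hn n
  -- summing over `k`
  have hsum : ∑' k : ℕ, ENNReal.ofReal (Real.log (k + 1)) * (∫⁻ t in Set.Ioi 0, Ψ t *
        ENNReal.ofReal (Real.exp (-accum φ' t) * accum φ' t ^ k / k.factorial)) ≤
      ∫⁻ t in Set.Ioi 0, Ψ t * ENNReal.ofReal (Real.log (1 + t)) := by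
    calc _ = ∑' k : ℕ, ∫⁻ t in Set.Ioi 0, Ψ t * (ENNReal.ofReal (Real.log (k + 1)) *
        ENNReal.ofReal (Real.exp (-accum φ' t) * accum φ' t ^ k / k.factorial)) := by
          refine tsum_congr fun k => ?_
          rw [← lintegral_const_mul _ (by fun_prop)]
          exact lintegral_congr fun t => mul_left_comm _ _ _
      _ = ∫⁻ t in Set.Ioi 0, ∑' k : ℕ, Ψ t * (ENNReal.ofReal (Real.log (k + 1)) *
        ENNReal.ofReal (Real.exp (-accum φ' t) * accum φ' t ^ k / k.factorial)) :=
          (lintegral_tsum fun k => by fun_prop).symm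
      _ ≤ _ := by
          refine setLIntegral_mono (by fun_prop) fun t ht => ?_
          have ht : (0 : ℝ) < t := ht
          rw [ENNReal.tsum_mul_left]
          have hA := accum_nonneg hφ'm h0 h1 ht.le
          refine mul_le_mul_right ((tsum_log_mul_poisson_le hA).trans ?_) _
          refine ENNReal.ofReal_le_ofReal (Real.log_le_log (by linarith) ?_)
          linarith [accum_le hφ'm h0 h1 ht.le]
  -- the change of variables
  have hchange : ∫⁻ t in Set.Ioi 0, Ψ t * ENNReal.ofReal (Real.log (1 + t)) =
      ∫⁻ z, f z * (∫⁻ u in Set.Ioi 0,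
        ψ (ENNReal.ofReal u) * ENNReal.ofReal (Real.log (1 + u * (f z).toReal))) ∂Q := by
    calc _ = ∫⁻ t in Set.Ioi 0, ∫⁻ z, ψ (ENNReal.ofReal t / f z) *
          ENNReal.ofReal (Real.log (1 + t)) ∂Q :=
          lintegral_congr fun t => (lintegral_mul_const _ (by fun_prop)).symm
      _ = ∫⁻ z, (∫⁻ t in Set.Ioi 0, ψ (ENNReal.ofReal t / f z) *
          ENNReal.ofReal (Real.log (1 + t))) ∂Q :=
          lintegral_lintegral_swap (by unfold Function.uncurry; fun_prop)
      _ = _ := by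
          refine lintegral_congr_ae ?_
          filter_upwards [hftop] with z hz
          exact setLIntegral_Ioi_comp_div
            (G := fun t x => ψ x * ENNReal.ofReal (Real.log (1 + t)))
            (by unfold Function.uncurry; fun_prop) (by simp [hψtop]) hz
  have hHtot : ∫⁻ t in Set.Ioi 0, (1 - Φ t) =
      ∫⁻ u in Set.Ioi 0, (1 - φ (ENNReal.ofReal u)) := by
    calc _ = ∫⁻ t in Set.Ioi 0, ∫⁻ z, (1 - φ (ENNReal.ofReal t / f z)) ∂Q := by
          refine lintegral_congr fun t => ?_
          rw [lintegral_sub (by fun_prop) ((hΦ1 t).trans_lt ENNReal.one_lt_top).ne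
            (ae_of_all _ fun z => hφ1 _)]
          simp [Φ]
      _ = ∫⁻ z, (∫⁻ t in Set.Ioi 0, (1 - φ (ENNReal.ofReal t / f z))) ∂Q :=
          lintegral_lintegral_swap (by unfold Function.uncurry; fun_prop)
      _ = ∫⁻ z, f z * (∫⁻ u in Set.Ioi 0, (1 - φ (ENNReal.ofReal u))) ∂Q := by
          refine lintegral_congr_ae ?_
          filter_upwards [hftop] with z hz
          exact setLIntegral_Ioi_comp_div (G := fun _ x => 1 - φ x)
            (by unfold Function.uncurry; fun_prop) (by simp [hφtop]) hz
      _ = _ := by rw [lintegral_mul_const _ hf, hf1, one_mul]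
  -- the exponent `R - accum φ' R` eventually exceeds any `H' < H`
  have hR : ∀ H' < H, ∃ R, H' ≤ R - accum φ' R := by
    intro H' hH'
    rcases lt_or_ge H' 0 with hneg | hpos
    · exact ⟨0, by simpa [accum] using hneg.le⟩
    have hlt : ENNReal.ofReal H' < ∫⁻ t in Set.Ioi 0, (1 - Φ t) := by
      rw [hHtot]
      exact lt_of_lt_of_le ((ENNReal.ofReal_lt_ofReal_iff (by linarith)).2 hH') hH
    have hU : Set.Ioi (0 : ℝ) = ⋃ n : ℕ, Set.Ioc 0 (n : ℝ) := by
      ext v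
      simp only [Set.mem_Ioi, Set.mem_iUnion, Set.mem_Ioc]
      exact ⟨fun hv => (exists_nat_ge v).imp fun n hn => ⟨hv, hn⟩, fun ⟨_, hv⟩ => hv.1⟩
    have hmono : Monotone fun n : ℕ => Set.Ioc (0 : ℝ) n := fun m n hmn =>
      Set.Ioc_subset_Ioc_right (by exact_mod_cast hmn)
    rw [hU, setLIntegral_iUnion_of_directed _ hmono.directed_le] at hlt
    obtain ⟨n, hn⟩ := lt_iSup_iff.1 hlt
    refine ⟨n, ?_⟩
    have hn0 : (0 : ℝ) ≤ n := n.cast_nonneg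
    have hval : ∫⁻ t in Set.Ioc 0 (n : ℝ), (1 - Φ t) = ENNReal.ofReal (n - accum φ' n) := by
      have : (n : ℝ) - accum φ' n = ∫ t in (0 : ℝ)..n, (1 - φ' t) := by
        rw [intervalIntegral.integral_sub (by simp)
          (intervalIntegrable_of_mem_Icc hφ'm h0 h1 _ _)]
        simp [accum]
      rw [this, intervalIntegral.integral_of_le hn0, ofReal_integral_eq_lintegral_ofReal]
      · refine lintegral_congr fun t => ?_
        rw [ENNReal.ofReal_sub _ (h0 t), hofReal, ENNReal.ofReal_one]
      · have := (intervalIntegrable_const (c := (1 : ℝ))).sub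
          (intervalIntegrable_of_mem_Icc hφ'm h0 h1 0 n)
        rwa [intervalIntegrable_iff_integrableOn_Ioc_of_le hn0] at this
      · exact ae_of_all _ fun t => by simpa using h1 t
    rw [hval] at hn
    exact ((ENNReal.ofReal_lt_ofReal_iff_of_nonneg hpos).1 hn).le
  have hH' : ∀ H' < H, ∑' k : ℕ, ENNReal.ofReal (Real.log (k + 1)) *
      ∫⁻ ω, ψ (tilted f (fun i => T i ω) (fun i => Z i ω) k) * ⨅ n,
        ∏ i ∈ (Finset.range n).erase k, φ (tilted f (fun i => T i ω) (fun i => Z i ω) i) ∂μ ≤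
      ENNReal.ofReal (Real.exp (-H')) * ∫⁻ z, f z * (∫⁻ u in Set.Ioi 0,
        ψ (ENNReal.ofReal u) * ENNReal.ofReal (Real.log (1 + u * (f z).toReal))) ∂Q := by
    intro H' hlt
    obtain ⟨R, hR⟩ := hR H' hlt
    rw [← hchange]
    refine le_trans ?_ (mul_le_mul_right hsum _)
    rw [← ENNReal.tsum_mul_left]
    refine ENNReal.tsum_le_tsum fun k => ?_
    rw [mul_left_comm]
    refine mul_le_mul_right ((hterm k R).trans (mul_le_mul_left ?_ _)) _
    exact ENNReal.ofReal_le_ofReal (Real.exp_le_exp.2 (by linarith))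
  have hlim : Filter.Tendsto (fun H' : ℝ => ENNReal.ofReal (Real.exp (-H')) *
      ∫⁻ z, f z * (∫⁻ u in Set.Ioi 0,
        ψ (ENNReal.ofReal u) * ENNReal.ofReal (Real.log (1 + u * (f z).toReal))) ∂Q)
      (nhdsWithin H (Set.Iio H)) (nhds (ENNReal.ofReal (Real.exp (-H)) *
      ∫⁻ z, f z * (∫⁻ u in Set.Ioi 0,
        ψ (ENNReal.ofReal u) * ENNReal.ofReal (Real.log (1 + u * (f z).toReal))) ∂Q)) := by
    refine ENNReal.Tendsto.mul_const ?_ (Or.inl ?_)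
    · refine ENNReal.tendsto_ofReal (Filter.Tendsto.mono_left ?_ nhdsWithin_le_nhds)
      exact (Real.continuous_exp.comp continuous_neg).tendsto H
    · simpa using Real.exp_pos _
  refine ge_of_tendsto hlim ?_
  filter_upwards [self_mem_nhdsWithin] with H' using hH' H'

end marked

/-! ### From the tilted arrival time to the relative entropy -/

/-- The pointwise inequality behind the refined constant: Jensen's inequality for the concave
function `log`, applied to `F^{-η} + u^η` and in the form of its tangent line at `M`, with all
terms moved to the side where they are nonnegative. -/
lemma mul_log_one_add_mul_le {F u η M : ℝ} (hF : 0 ≤ F) (hu : 0 < u) (hη : 0 < η) (hη1 : η ≤ 1)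
    (hM : 1 ≤ M) :
    F * Real.log (1 + u * F) + (1 + F / η) ≤
      klFun F + (F + F * (Real.log M / η)) + ((1 - η) * F + η) / (η * M) +
        F * (u ^ η / (η * M)) := by
  have hM0 : 0 < M := by linarith
  rcases hF.eq_or_lt with rfl | hF
  · have : 0 < η / (η * M) := by positivity
    simp [klFun]
    positivity
  have h1 : Real.log (1 + u * F) ≤ 1 / η * Real.log (1 + u ^ η * F ^ η) := by
    have h2 : (1 + u * F) ^ η ≤ 1 + u ^ η * F ^ η := by
      have := Real.rpow_add_le_add_rpow (p := η) zero_le_one (mul_pos hu hF).le hη.le hη1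
      rwa [Real.one_rpow, Real.mul_rpow hu.le hF.le] at this
    have h3 : η * Real.log (1 + u * F) ≤ Real.log (1 + u ^ η * F ^ η) := by
      rw [← Real.log_rpow (by positivity)]
      exact Real.log_le_log (by positivity) h2
    rw [one_div, ← div_eq_inv_mul, le_div_iff₀ hη]
    linarith
  have hy : 0 < F ^ (-η) + u ^ η := by positivity
  have h2 : Real.log (1 + u ^ η * F ^ η) = η * Real.log F + Real.log (F ^ (-η) + u ^ η) := by
    rw [← Real.log_rpow hF, ← Real.log_mul (by positivity) hy.ne', mul_add, ← Real.rpow_add hF]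
    simp [mul_comm]
  have h3 : Real.log (F ^ (-η) + u ^ η) ≤ Real.log M + (F ^ (-η) + u ^ η) / M - 1 := by
    have := Real.log_le_sub_one_of_pos (div_pos hy hM0)
    rw [Real.log_div hy.ne' hM0.ne'] at this
    linarith
  have h4 : F * F ^ (-η) ≤ (1 - η) * F + η := by
    have := Real.geom_mean_le_arith_mean2_weighted (sub_nonneg.2 hη1) hη.le hF.le zero_le_one
      (by ring)
    rw [Real.one_rpow, mul_one, mul_one] at this
    rwa [sub_eq_add_neg, Real.rpow_add hF, Real.rpow_one, ← sub_eq_add_neg] at this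
  have h5 : F * Real.log (1 + u * F) ≤
      F * (1 / η * (η * Real.log F + (Real.log M + (F ^ (-η) + u ^ η) / M - 1))) := by
    refine mul_le_mul_of_nonneg_left (h1.trans ?_) hF.le
    refine mul_le_mul_of_nonneg_left ?_ (by positivity)
    linarith
  have h6 : F * (1 / η * (η * Real.log F + (Real.log M + (F ^ (-η) + u ^ η) / M - 1))) =
      F * Real.log F + F * (Real.log M / η) - F / η + (F * F ^ (-η)) / (η * M) +
        F * (u ^ η / (η * M)) := by
    field_simp
    ring
  have h7 : (F * F ^ (-η)) / (η * M) ≤ ((1 - η) * F + η) / (η * M) := by gcongr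
  rw [klFun]
  linarith

/-- If `ν` is a probability measure on `(0, ∞)` whose moment of order `η` is at most `C`, then
`∫∫ f(z) log (1 + u f(z))` exceeds the relative entropy with density `f` by at most
`η⁻¹ log (C + 1)`. -/
lemma lintegral_mul_log_one_add_mul_le {𝒵 : Type*} [MeasurableSpace 𝒵] {Q : Measure 𝒵}
    [IsProbabilityMeasure Q] {f : 𝒵 → ℝ≥0∞} (hf : Measurable f) (hf1 : ∫⁻ z, f z ∂Q = 1)
    {ν : Measure ℝ} [IsProbabilityMeasure ν] (hν : ∀ᵐ u ∂ν, 0 < u) {η C : ℝ} (hη : 0 < η)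
    (hη1 : η ≤ 1) (hC : 0 ≤ C) (hνC : ∫⁻ u, ENNReal.ofReal (u ^ η) ∂ν ≤ ENNReal.ofReal C) :
    ∫⁻ z, f z * ∫⁻ u, ENNReal.ofReal (Real.log (1 + u * (f z).toReal)) ∂ν ∂Q ≤
      ∫⁻ z, ENNReal.ofReal (klFun (f z).toReal) ∂Q +
        ENNReal.ofReal (1 / η * Real.log (C + 1)) := by
  set M : ℝ := C + 1 with hMdef
  have hM : 1 ≤ M := by linarith
  have hM0 : 0 < M := by linarith
  have hlogM : 0 ≤ Real.log M := Real.log_nonneg hM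
  have hftop : ∀ᵐ z ∂Q, f z ≠ ∞ := by
    filter_upwards [ae_lt_top hf (by simp [hf1])] with z hz using hz.ne
  have hη1' : 0 ≤ 1 - η := by linarith
  -- the pointwise inequality, integrated over `u`
  have hz : ∀ᵐ z ∂Q,
      f z * ∫⁻ u, ENNReal.ofReal (Real.log (1 + u * (f z).toReal)) ∂ν +
        (1 + f z * ENNReal.ofReal (1 / η)) ≤
      ENNReal.ofReal (klFun (f z).toReal) + (f z + f z * ENNReal.ofReal (Real.log M / η)) +
        (f z * ENNReal.ofReal ((1 - η) / (η * M)) + ENNReal.ofReal (1 / M)) +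
        f z * ENNReal.ofReal (C / (η * M)) := by
    filter_upwards [hftop] with z hz
    obtain ⟨F, hF, hFz⟩ : ∃ F : ℝ, 0 ≤ F ∧ f z = ENNReal.ofReal F :=
      ⟨(f z).toReal, ENNReal.toReal_nonneg, (ENNReal.ofReal_toReal hz).symm⟩
    rw [hFz, ENNReal.toReal_ofReal hF]
    have hkl : 0 ≤ klFun F := klFun_nonneg hF
    calc ENNReal.ofReal F * ∫⁻ u, ENNReal.ofReal (Real.log (1 + u * F)) ∂ν +
          (1 + ENNReal.ofReal F * ENNReal.ofReal (1 / η))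
        = ∫⁻ u, (ENNReal.ofReal F * ENNReal.ofReal (Real.log (1 + u * F)) +
          (1 + ENNReal.ofReal F * ENNReal.ofReal (1 / η))) ∂ν := by
          rw [lintegral_add_right _ measurable_const, lintegral_const_mul _ (by fun_prop)]
          simp
      _ ≤ ∫⁻ u, (ENNReal.ofReal (klFun F) + (ENNReal.ofReal F +
            ENNReal.ofReal F * ENNReal.ofReal (Real.log M / η)) +
          (ENNReal.ofReal F * ENNReal.ofReal ((1 - η) / (η * M)) + ENNReal.ofReal (1 / M)) +
          ENNReal.ofReal F * (ENNReal.ofReal (1 / (η * M)) * ENNReal.ofReal (u ^ η))) ∂ν := by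
          refine lintegral_mono_ae ?_
          filter_upwards [hν] with u hu
          have key := mul_log_one_add_mul_le hF hu hη hη1 hM
          have hlog : 0 ≤ Real.log (1 + u * F) :=
            Real.log_nonneg (by have := mul_nonneg hu.le hF; linarith)
          have huη : 0 ≤ u ^ η := by positivity
          simp only [← ENNReal.ofReal_one]
          repeat rw [← ENNReal.ofReal_mul (by positivity)]
          repeat rw [← ENNReal.ofReal_add (by positivity) (by positivity)]
          refine ENNReal.ofReal_le_ofReal ?_
          convert key using 1
          · ring
          · field_simp
      _ ≤ _ := by
          rw [lintegral_add_left measurable_const, lintegral_const_mul _ (by fun_prop),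
            lintegral_const_mul _ (by fun_prop)]
          simp only [lintegral_const, measure_univ, mul_one]
          refine add_le_add le_rfl (mul_le_mul_right ?_ _)
          calc _ ≤ ENNReal.ofReal (1 / (η * M)) * ENNReal.ofReal C := mul_le_mul_right hνC _
            _ = _ := by
              rw [← ENNReal.ofReal_mul (by positivity)]
              congr 1; ring
  have hint := lintegral_mono_ae hz
  have hm1 : Measurable fun z => ENNReal.ofReal (klFun (f z).toReal) :=
    (measurable_klFun.comp hf.ennreal_toReal).ennreal_ofReal
  repeat rw [lintegral_add_right _ (by fun_prop)] at hint
  simp only [lintegral_mul_const _ hf, hf1, one_mul, lintegral_const, measure_univ,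
    mul_one] at hint
  have hfin : (1 + ENNReal.ofReal (1 / η)) ≠ ∞ := by simp
  refine (ENNReal.add_le_add_iff_right hfin).1 (hint.trans (le_of_eq ?_))
  simp only [add_assoc]
  congr 1
  simp only [← ENNReal.ofReal_one]
  repeat rw [← ENNReal.ofReal_add (by positivity) (by positivity)]
  congr 1
  field_simp
  rw [hMdef]; ring

/-! ### Selection with a finite parameter -/

/-- `exp (-s y)` for `y ∈ [0, ∞]` and `s > 0`, with `exp (-∞) = 0`. -/
noncomputable def expNeg (s : ℝ) (y : ℝ≥0∞) : ℝ≥0∞ :=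
  if y = ∞ then 0 else ENNReal.ofReal (Real.exp (-(s * y.toReal)))

@[fun_prop]
lemma measurable_uncurry_expNeg : Measurable (Function.uncurry expNeg) := by
  refine Measurable.ite ?_ measurable_const (by fun_prop)
  exact measurable_snd (measurableSet_singleton ∞)

lemma measurable_expNeg (s : ℝ) : Measurable (expNeg s) :=
  measurable_uncurry_expNeg.comp (f := fun y => (s, y)) (by fun_prop)

lemma expNeg_of_ne_top {y : ℝ≥0∞} (hy : y ≠ ∞) (s : ℝ) :
    expNeg s y = ENNReal.ofReal (Real.exp (-(s * y.toReal))) := if_neg hy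

lemma expNeg_ofReal {y : ℝ} (hy : 0 ≤ y) (s : ℝ) :
    expNeg s (ENNReal.ofReal y) = ENNReal.ofReal (Real.exp (-(s * y))) := by
  rw [expNeg_of_ne_top ENNReal.ofReal_ne_top, ENNReal.toReal_ofReal hy]

lemma expNeg_le_one {s : ℝ} (hs : 0 ≤ s) (y : ℝ≥0∞) : expNeg s y ≤ 1 := by
  unfold expNeg
  split_ifs
  · exact zero_le_one
  · rw [ENNReal.ofReal_le_one, Real.exp_le_one_iff]
    have := mul_nonneg hs (ENNReal.toReal_nonneg (a := y))
    linarith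

lemma mul_expNeg_le {s : ℝ} (hs : 0 < s) (y : ℝ≥0∞) :
    y * expNeg s y ≤ ENNReal.ofReal (1 / s) := by
  rcases eq_or_ne y ∞ with rfl | hy
  · simp [expNeg]
  rw [expNeg_of_ne_top hy]
  obtain ⟨x, hx, rfl⟩ : ∃ x : ℝ, 0 ≤ x ∧ y = ENNReal.ofReal x :=
    ⟨y.toReal, ENNReal.toReal_nonneg, (ENNReal.ofReal_toReal hy).symm⟩
  rw [ENNReal.toReal_ofReal hx, ← ENNReal.ofReal_mul hx]
  refine ENNReal.ofReal_le_ofReal ?_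
  have h1 : s * x ≤ Real.exp (s * x) := by linarith [Real.add_one_le_exp (s * x)]
  rw [Real.exp_neg, le_div_iff₀ hs, ← div_eq_mul_inv, div_mul_eq_mul_div,
    div_le_one (Real.exp_pos _)]
  linarith

/-- The selection probability of a point as an integral in which all other points appear in a
product, from `y / S = ∫₀^∞ y exp (-s S) ds`. If the sum is infinite the left side vanishes. -/
lemma div_tsum_le_lintegral (y : ℕ → ℝ≥0∞) (k : ℕ) :
    y k / ∑' i, y i ≤ ∫⁻ s in Set.Ioi (0 : ℝ), y k * expNeg s (y k) *
      ⨅ n, ∏ i ∈ (Finset.range n).erase k, expNeg s (y i) := by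
  rcases eq_or_ne (∑' i, y i) ∞ with htop | htop
  · simp [htop]
  rcases eq_or_ne (y k) 0 with h0 | h0
  · simp [h0]
  set S := (∑' i, y i).toReal with hS
  have hy : ∀ i, y i ≠ ∞ := fun i => ENNReal.ne_top_of_tsum_ne_top htop i
  have hSpos : 0 < S := by
    refine ENNReal.toReal_pos (fun h => h0 ?_) htop
    exact le_antisymm (h ▸ ENNReal.le_tsum k) zero_le
  have hpart : ∀ n, (y k).toReal + ∑ i ∈ (Finset.range n).erase k, (y i).toReal ≤ S := fun n => by
    rw [← ENNReal.toReal_sum fun i _ => hy i, ← ENNReal.toReal_add (hy k)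
      (ENNReal.sum_ne_top.2 fun i _ => hy i), hS]
    refine ENNReal.toReal_mono htop ?_
    rw [← Finset.sum_insert (Finset.notMem_erase k _)]
    exact ENNReal.sum_le_tsum _
  have hI : ∫⁻ s in Set.Ioi (0 : ℝ), ENNReal.ofReal (Real.exp (-S * s)) =
      ENNReal.ofReal (1 / S) := by
    rw [← ofReal_integral_eq_lintegral_ofReal]
    · rw [integral_exp_mul_Ioi (by linarith) 0]
      congr 1; simp
    · exact integrableOn_exp_mul_Ioi (by linarith) 0
    · exact ae_of_all _ fun s => (Real.exp_pos _).le
  calc y k / ∑' i, y i = y k * ENNReal.ofReal (1 / S) := by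
        rw [div_eq_mul_inv, one_div, ENNReal.ofReal_inv_of_pos hSpos, hS,
          ENNReal.ofReal_toReal htop]
    _ = ∫⁻ s in Set.Ioi (0 : ℝ), y k * ENNReal.ofReal (Real.exp (-S * s)) := by
        rw [lintegral_const_mul _ (by fun_prop), hI]
    _ ≤ _ := by
        refine setLIntegral_mono' measurableSet_Ioi fun s hs => ?_
        have hs : 0 < s := hs
        rw [mul_assoc]
        refine mul_le_mul_right ?_ _
        have hle : ENNReal.ofReal (Real.exp (-(s * (S - (y k).toReal)))) ≤
            ⨅ n, ∏ i ∈ (Finset.range n).erase k, expNeg s (y i) := by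
          refine le_iInf fun n => ?_
          rw [Finset.prod_congr rfl fun i _ => expNeg_of_ne_top (hy i) s,
            ← ENNReal.ofReal_prod_of_nonneg fun i _ => (Real.exp_pos _).le, ← Real.exp_sum,
            Finset.sum_neg_distrib, ← Finset.mul_sum]
          refine ENNReal.ofReal_le_ofReal (Real.exp_le_exp.2 (neg_le_neg ?_))
          refine mul_le_mul_of_nonneg_left ?_ hs.le
          linarith [hpart n]
        refine le_trans (le_of_eq ?_) (mul_le_mul_right hle _)
        rw [expNeg_of_ne_top (hy k), ← ENNReal.ofReal_mul (Real.exp_pos _).le, ← Real.exp_add]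
        congr 2; ring

section gamma

variable {a : ℝ} (ha : 1 < a)

include ha

lemma lintegral_rpow_mul_mul_expNeg {s η : ℝ} (hs : 0 < s) (hηa : η + 1 < a) :
    ∫⁻ u in Set.Ioi (0 : ℝ), ENNReal.ofReal (u ^ η) *
      (ENNReal.ofReal u ^ (-a) * expNeg s (ENNReal.ofReal u ^ (-a))) =
    ENNReal.ofReal (a⁻¹ * Real.Gamma (1 - (η + 1) * a⁻¹) * s ^ ((η + 1) * a⁻¹ - 1)) := by
  have ha0 : 0 < a := by linarith
  set p := (η + 1) * a⁻¹ with hp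
  have hp1 : 0 < 1 - p := by
    rw [hp, ← div_eq_mul_inv, sub_pos, div_lt_one ha0]; exact hηa
  have hval : ∫ u in Set.Ioi (0 : ℝ), u ^ (η - a) * Real.exp (-(s * u ^ (-a))) =
      a⁻¹ * Real.Gamma (1 - p) * s ^ (p - 1) := by
    have h1 := Real.integral_rpow_mul_exp_neg_mul_Ioi hp1 hs
    have h2 := integral_comp_rpow_Ioi
      (fun y : ℝ => a⁻¹ * (y ^ (1 - p - 1) * Real.exp (-(s * y)))) (neg_ne_zero.2 ha0.ne')
    rw [integral_const_mul, h1] at h2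
    have h3 : (1 / s) ^ (1 - p) = s ^ (p - 1) := by
      rw [one_div, Real.inv_rpow hs.le, ← Real.rpow_neg hs.le]; congr 1; ring
    rw [h3] at h2
    rw [mul_assoc, mul_comm (Real.Gamma _), ← h2]
    refine setIntegral_congr_fun measurableSet_Ioi fun u hu => ?_
    have hu : 0 < u := hu
    have hpow : u ^ (η - a) = u ^ (-a - 1) * (u ^ (-a)) ^ (1 - p - 1) := by
      rw [← Real.rpow_mul hu.le, ← Real.rpow_add hu]
      congr 1
      rw [hp]; field_simp; ring
    simp only [smul_eq_mul, abs_neg, abs_of_pos ha0]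
    rw [hpow]
    field_simp
  have hpos : 0 < a⁻¹ * Real.Gamma (1 - p) * s ^ (p - 1) := by
    have := Real.Gamma_pos_of_pos hp1
    positivity
  rw [← hval, ofReal_integral_eq_lintegral_ofReal]
  · refine setLIntegral_congr_fun measurableSet_Ioi fun u hu => ?_
    have hu : 0 < u := hu
    have hua : 0 ≤ u ^ (-a) := by positivity
    rw [ENNReal.ofReal_rpow_of_pos hu, expNeg_ofReal hua, ← ENNReal.ofReal_mul hua,
      ← ENNReal.ofReal_mul (by positivity), ← mul_assoc, ← Real.rpow_add hu, ← sub_eq_add_neg]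
  · by_contra h
    rw [integral_undef h] at hval
    linarith
  · refine (ae_restrict_iff' measurableSet_Ioi).2 (ae_of_all _ fun u hu => ?_)
    have hu : 0 < u := hu
    simp only [Pi.zero_apply]
    positivity

/-- The exponent of the Laplace functional `E exp (-s ∑ T̃ᵢ^(-a)) = exp (-Γ(1 - 1/a) s^(1/a))`. -/
lemma lintegral_one_sub_expNeg {s : ℝ} (hs : 0 < s) :
    ∫⁻ u in Set.Ioi (0 : ℝ), (1 - expNeg s (ENNReal.ofReal u ^ (-a))) =
      ENNReal.ofReal (Real.Gamma (1 - a⁻¹) * s ^ a⁻¹) := by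
  have ha0 : 0 < a := by linarith
  calc _ = ∫⁻ u in Set.Ioi (0 : ℝ), ∫⁻ x in Set.Ioc 0 s,
        ENNReal.ofReal u ^ (-a) * expNeg x (ENNReal.ofReal u ^ (-a)) := by
        refine setLIntegral_congr_fun measurableSet_Ioi fun u hu => ?_
        have hu : 0 < u := hu
        have hua : 0 ≤ u ^ (-a) := by positivity
        rw [ENNReal.ofReal_rpow_of_pos hu, expNeg_ofReal hua]
        simp only [expNeg_ofReal hua, ← ENNReal.ofReal_mul hua]
        rw [← ENNReal.ofReal_one, ← ENNReal.ofReal_sub _ (Real.exp_pos _).le,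
          ← ofReal_integral_eq_lintegral_ofReal, ← intervalIntegral.integral_of_le hs.le]
        · congr 1
          have hd : ∀ x ∈ Set.uIcc 0 s, HasDerivAt (fun x => -Real.exp (-(x * u ^ (-a))))
              (u ^ (-a) * Real.exp (-(x * u ^ (-a)))) x := fun x _ => by
            have := (((hasDerivAt_id x).mul_const (u ^ (-a))).neg.exp).neg
            convert! this using 1
            simp; ring
          rw [intervalIntegral.integral_eq_sub_of_hasDerivAt hd
            (Continuous.intervalIntegrable (by fun_prop) _ _)]
          simp; ring
        · exact (Continuous.integrableOn_Icc (by fun_prop)).mono_set Set.Ioc_subset_Icc_self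
        · exact ae_of_all _ fun x => by positivity
    _ = ∫⁻ x in Set.Ioc 0 s, ∫⁻ u in Set.Ioi (0 : ℝ),
        ENNReal.ofReal u ^ (-a) * expNeg x (ENNReal.ofReal u ^ (-a)) := by
        refine lintegral_lintegral_swap (Measurable.aemeasurable ?_)
        have : Measurable fun p : ℝ × ℝ => expNeg p.2 (ENNReal.ofReal p.1 ^ (-a)) :=
          measurable_uncurry_expNeg.comp
            (f := fun p : ℝ × ℝ => (p.2, ENNReal.ofReal p.1 ^ (-a))) (by fun_prop)
        unfold Function.uncurry
        fun_prop
    _ = ∫⁻ x in Set.Ioc 0 s, ENNReal.ofReal (a⁻¹ * Real.Gamma (1 - a⁻¹) * x ^ (a⁻¹ - 1)) := by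
        refine setLIntegral_congr_fun measurableSet_Ioc fun x hx => ?_
        have := lintegral_rpow_mul_mul_expNeg ha hx.1 (η := 0) (by linarith)
        simpa using this
    _ = _ := by
        have hg : 0 < Real.Gamma (1 - a⁻¹) :=
          Real.Gamma_pos_of_pos (sub_pos.2 (inv_lt_one_of_one_lt₀ ha))
        have hainv : 0 < a⁻¹ := by positivity
        rw [← ofReal_integral_eq_lintegral_ofReal, ← intervalIntegral.integral_of_le hs.le]
        · congr 1
          rw [intervalIntegral.integral_const_mul, integral_rpow (Or.inl (by linarith))]
          simp only [sub_add_cancel, Real.zero_rpow hainv.ne', sub_zero]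
          field_simp
        · have := (intervalIntegral.intervalIntegrable_rpow' (a := 0) (b := s)
            (r := a⁻¹ - 1) (by linarith)).const_mul (a⁻¹ * Real.Gamma (1 - a⁻¹))
          rwa [intervalIntegrable_iff_integrableOn_Ioc_of_le hs.le] at this
        · refine (ae_restrict_iff' measurableSet_Ioc).2 (ae_of_all _ fun x hx => ?_)
          have := hx.1
          simp only [Pi.zero_apply]
          positivity

/-- The density of the tilted arrival time of the selected point, for the parameter `a`. -/
noncomputable def selectedDensity (a u : ℝ) : ℝ≥0∞ :=
  ∫⁻ s in Set.Ioi (0 : ℝ), ENNReal.ofReal (Real.exp (-(Real.Gamma (1 - a⁻¹) * s ^ a⁻¹))) *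
    (ENNReal.ofReal u ^ (-a) * expNeg s (ENNReal.ofReal u ^ (-a)))

omit ha in
lemma measurable_selectedDensity_integrand : Measurable fun p : ℝ × ℝ =>
    ENNReal.ofReal (Real.exp (-(Real.Gamma (1 - a⁻¹) * p.2 ^ a⁻¹))) *
      (ENNReal.ofReal p.1 ^ (-a) * expNeg p.2 (ENNReal.ofReal p.1 ^ (-a))) := by
  have : Measurable fun p : ℝ × ℝ => expNeg p.2 (ENNReal.ofReal p.1 ^ (-a)) :=
    measurable_uncurry_expNeg.comp
      (f := fun p : ℝ × ℝ => (p.2, ENNReal.ofReal p.1 ^ (-a))) (by fun_prop)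
  fun_prop

omit ha in
lemma measurable_selectedDensity : Measurable (selectedDensity a) :=
  Measurable.lintegral_prod_right' measurable_selectedDensity_integrand

/-- The moments of the tilted arrival time of the selected point. -/
lemma lintegral_rpow_mul_selectedDensity {η : ℝ} (hη : 0 ≤ η) (hηa : η + 1 < a) :
    ∫⁻ u in Set.Ioi (0 : ℝ), selectedDensity a u * ENNReal.ofReal (u ^ η) =
      ENNReal.ofReal (Real.Gamma (1 - (η + 1) * a⁻¹) * Real.Gamma (η + 1) /
        Real.Gamma (1 - a⁻¹) ^ (η + 1)) := by
  have ha0 : 0 < a := by linarith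
  have hainv : 0 < a⁻¹ := by positivity
  set c := Real.Gamma (1 - a⁻¹) with hc
  have hcpos : 0 < c := Real.Gamma_pos_of_pos (sub_pos.2 (inv_lt_one_of_one_lt₀ ha))
  set p := (η + 1) * a⁻¹ with hp
  have hp0 : 0 < p := by positivity
  have hp1 : 0 < 1 - p := by
    rw [hp, ← div_eq_mul_inv, sub_pos, div_lt_one ha0]; exact hηa
  have hG : 0 < Real.Gamma (1 - p) := Real.Gamma_pos_of_pos hp1
  have hm := measurable_selectedDensity_integrand (a := a)
  calc _ = ∫⁻ u in Set.Ioi (0 : ℝ), ∫⁻ s in Set.Ioi (0 : ℝ),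
        ENNReal.ofReal (Real.exp (-(c * s ^ a⁻¹))) *
        (ENNReal.ofReal u ^ (-a) * expNeg s (ENNReal.ofReal u ^ (-a))) *
          ENNReal.ofReal (u ^ η) := by
        exact lintegral_congr fun u =>
          (lintegral_mul_const _ (hm.comp (measurable_prodMk_left (x := u)))).symm
    _ = ∫⁻ s in Set.Ioi (0 : ℝ), ∫⁻ u in Set.Ioi (0 : ℝ),
        ENNReal.ofReal (Real.exp (-(c * s ^ a⁻¹))) *
        (ENNReal.ofReal u ^ (-a) * expNeg s (ENNReal.ofReal u ^ (-a))) *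
          ENNReal.ofReal (u ^ η) :=
        lintegral_lintegral_swap (Measurable.aemeasurable (by
          unfold Function.uncurry; exact hm.mul (by fun_prop)))
    _ = ∫⁻ s in Set.Ioi (0 : ℝ), ENNReal.ofReal
        (a⁻¹ * Real.Gamma (1 - p) * (s ^ (p - 1) * Real.exp (-c * s ^ a⁻¹))) := by
        refine setLIntegral_congr_fun measurableSet_Ioi fun s hs => ?_
        have hs : 0 < s := hs
        have hm' : Measurable fun u => ENNReal.ofReal (u ^ η) *
            (ENNReal.ofReal u ^ (-a) * expNeg s (ENNReal.ofReal u ^ (-a))) := by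
          have := measurable_expNeg s
          fun_prop
        have : ∀ u : ℝ, ENNReal.ofReal (Real.exp (-(c * s ^ a⁻¹))) *
            (ENNReal.ofReal u ^ (-a) * expNeg s (ENNReal.ofReal u ^ (-a))) *
            ENNReal.ofReal (u ^ η) = ENNReal.ofReal (Real.exp (-(c * s ^ a⁻¹))) *
            (ENNReal.ofReal (u ^ η) *
              (ENNReal.ofReal u ^ (-a) * expNeg s (ENNReal.ofReal u ^ (-a)))) := fun u => by
          ring
        simp only [this]
        rw [lintegral_const_mul _ hm', lintegral_rpow_mul_mul_expNeg ha hs hηa,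
          ← ENNReal.ofReal_mul (Real.exp_pos _).le]
        congr 1
        rw [neg_mul]; ring
    _ = _ := by
        have hval := integral_rpow_mul_exp_neg_mul_rpow (p := a⁻¹) (q := p - 1) (b := c) hainv
          (by linarith) hcpos
        have hpa : (p - 1 + 1) / a⁻¹ = η + 1 := by rw [hp]; field_simp; ring
        have hpa' : -(p - 1 + 1) / a⁻¹ = -(η + 1) := by rw [neg_div, hpa]
        rw [hpa, hpa', Real.rpow_neg hcpos.le] at hval
        have hpos : 0 < (c ^ (η + 1))⁻¹ * (1 / a⁻¹) * Real.Gamma (η + 1) := by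
          have := Real.Gamma_pos_of_pos (show 0 < η + 1 by linarith)
          positivity
        rw [← ofReal_integral_eq_lintegral_ofReal]
        · rw [integral_const_mul, hval]
          congr 1
          field_simp
        · refine Integrable.const_mul ?_ _
          by_contra h
          rw [integral_undef h] at hval
          linarith
        · refine (ae_restrict_iff' measurableSet_Ioi).2 (ae_of_all _ fun s hs => ?_)
          have hs : 0 < s := hs
          simp only [Pi.zero_apply]
          positivity

end gamma

section finite

variable {𝒵 Ω : Type*} [MeasurableSpace 𝒵] [MeasurableSpace Ω] {μ : Measure Ω}
  [IsProbabilityMeasure μ] {T : ℕ → Ω → ℝ} {Z : ℕ → Ω → 𝒵} {Q : Measure 𝒵}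

omit [IsProbabilityMeasure μ] in
lemma IsMarkedPoisson.measurable_tilted (h : IsMarkedPoisson T Z Q μ) {f : 𝒵 → ℝ≥0∞}
    (hf : Measurable f) (i : ℕ) :
    Measurable fun ω => tilted f (fun i => T i ω) (fun i => Z i ω) i := by
  have h1 := h.measurable i
  have h2 := h.measurable_Z i
  unfold tilted
  fun_prop

set_option maxHeartbeats 800000 in
/-- The refined bound for a fixed density and finite `α`: the selection probability is an integral
over `s` of functionals to which `IsMarkedPoisson.tsum_log_mul_lintegral_le` applies. -/
lemma IsMarkedPoisson.tsum_log_mul_selectProb_le_of_ne_top (h : IsMarkedPoisson T Z Q μ)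
    {f : 𝒵 → ℝ≥0∞} (hf : Measurable f) (hf1 : ∫⁻ z, f z ∂Q = 1) {α : ℝ≥0∞} (hα : 1 < α)
    (hαtop : α ≠ ∞) {η : ℝ} (hη : 0 < η) (hη1 : η ≤ 1) (hηα : ENNReal.ofReal η < α - 1) :
    ∑' k : ℕ, ENNReal.ofReal (Real.log (k + 1)) *
      ∫⁻ ω, selectProb α (tilted f (fun i => T i ω) (fun i => Z i ω)) k ∂μ ≤
    ∫⁻ z, ENNReal.ofReal (klFun (f z).toReal) ∂Q +
      ENNReal.ofReal (1 / η * Real.log (gammaCoeff α η + 1)) := by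
  have hQ : IsProbabilityMeasure Q := (h.law_Z 0).isProbabilityMeasure_iff.1 inferInstance
  set a := α.toReal with hadef
  have ha : 1 < a := by
    rw [hadef, ← ENNReal.toReal_one]
    exact (ENNReal.toReal_lt_toReal ENNReal.one_ne_top hαtop).2 hα
  have hηa : η + 1 < a := by
    rw [← ENNReal.ofReal_toReal hαtop, ← hadef, ← ENNReal.ofReal_one,
      ← ENNReal.ofReal_sub _ zero_le_one, ENNReal.ofReal_lt_ofReal_iff (by linarith)] at hηα
    linarith
  have ha0 : 0 < a := by linarith
  let c := Real.Gamma (1 - a⁻¹)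
  let τ : ℕ → Ω → ℝ≥0∞ := fun i ω => tilted f (fun i => T i ω) (fun i => Z i ω) i
  have hτ : ∀ i, Measurable (τ i) := h.measurable_tilted hf
  have hexp : ∀ i, Measurable fun p : ℝ × Ω => expNeg p.1 (τ i p.2 ^ (-a)) := fun i =>
    measurable_uncurry_expNeg.comp (f := fun p : ℝ × Ω => (p.1, τ i p.2 ^ (-a))) (by fun_prop)
  let G : ℕ → ℝ → Ω → ℝ≥0∞ := fun k s ω => τ k ω ^ (-a) * expNeg s (τ k ω ^ (-a)) *
      ⨅ n, ∏ i ∈ (Finset.range n).erase k, expNeg s (τ i ω ^ (-a))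
  have hG : ∀ k, Measurable fun p : ℝ × Ω => G k p.1 p.2 := fun k => by
    refine Measurable.mul ?_ (Measurable.iInf fun n => Finset.measurable_prod _ fun i _ => hexp i)
    have := hexp k
    fun_prop
  let L : ℝ → 𝒵 → ℝ≥0∞ := fun u z => ENNReal.ofReal (Real.log (1 + u * (f z).toReal))
  let D : ℝ → ℝ → ℝ≥0∞ := fun u s => ENNReal.ofReal (Real.exp (-(c * s ^ a⁻¹))) *
    (ENNReal.ofReal u ^ (-a) * expNeg s (ENNReal.ofReal u ^ (-a)))
  have hD : Measurable fun p : ℝ × ℝ => D p.1 p.2 := measurable_selectedDensity_integrand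
  -- the law of the selected tilted arrival time
  let ν : Measure ℝ := (volume.restrict (Set.Ioi 0)).withDensity (selectedDensity a)
  have hν : IsProbabilityMeasure ν := ⟨by
    have := lintegral_rpow_mul_selectedDensity ha le_rfl (by linarith)
    have hc : Real.Gamma (1 - a⁻¹) ≠ 0 :=
      (Real.Gamma_pos_of_pos (sub_pos.2 (inv_lt_one_of_one_lt₀ ha))).ne'
    simp only [Real.rpow_zero, ENNReal.ofReal_one, mul_one, zero_add, one_mul, Real.rpow_one,
      Real.Gamma_one, div_self hc] at this
    rw [withDensity_apply _ MeasurableSet.univ, Measure.restrict_univ, this]⟩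
  have hνpos : ∀ᵐ u ∂ν, 0 < u :=
    (withDensity_absolutelyContinuous _ _).ae_le (ae_restrict_mem measurableSet_Ioi)
  have hcoeff : gammaCoeff α η = Real.Gamma (1 - (η + 1) * a⁻¹) * Real.Gamma (η + 1) /
        Real.Gamma (1 - a⁻¹) ^ (η + 1) := by
    rw [gammaCoeff, ENNReal.toReal_inv]
  have hcoeff0 : 0 ≤ gammaCoeff α η := by
    have hp : 0 < 1 - (η + 1) * a⁻¹ := by
      rw [← div_eq_mul_inv, sub_pos, div_lt_one ha0]; exact hηa
    have h1 := Real.Gamma_pos_of_pos hp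
    have h2 := Real.Gamma_pos_of_pos (show 0 < η + 1 by linarith)
    have h3 := Real.Gamma_pos_of_pos (sub_pos.2 (inv_lt_one_of_one_lt₀ ha))
    rw [hcoeff]; positivity
  calc _ ≤ ∑' k : ℕ, ENNReal.ofReal (Real.log (k + 1)) *
        ∫⁻ ω, (∫⁻ s in Set.Ioi (0 : ℝ), G k s ω) ∂μ := by
        refine ENNReal.tsum_le_tsum fun k => mul_le_mul_right (lintegral_mono fun ω => ?_) _
        rw [selectProb, if_neg hαtop]
        exact div_tsum_le_lintegral (fun i => τ i ω ^ (-a)) k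
    _ = ∫⁻ s in Set.Ioi (0 : ℝ), ∑' k : ℕ, ENNReal.ofReal (Real.log (k + 1)) *
        ∫⁻ ω, G k s ω ∂μ := by
        have hGs : ∀ k, Measurable fun s => ∫⁻ ω, G k s ω ∂μ := fun k =>
          Measurable.lintegral_prod_right' (hG k)
        rw [lintegral_tsum fun k => by fun_prop]
        refine tsum_congr fun k => ?_
        rw [lintegral_const_mul _ (hGs k)]
        congr 1
        exact lintegral_lintegral_swap (f := fun ω s => G k s ω)
          ((hG k).comp measurable_swap).aemeasurable
    _ ≤ ∫⁻ s in Set.Ioi (0 : ℝ), ENNReal.ofReal (Real.exp (-(c * s ^ a⁻¹))) *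
        ∫⁻ z, f z * (∫⁻ u in Set.Ioi 0, ENNReal.ofReal u ^ (-a) *
          expNeg s (ENNReal.ofReal u ^ (-a)) * L u z) ∂Q := by
        refine setLIntegral_mono' measurableSet_Ioi fun s hs => ?_
        have hs : 0 < s := hs
        have hem := measurable_expNeg s
        exact h.tsum_log_mul_lintegral_le hf hf1 (φ := fun x => expNeg s (x ^ (-a)))
          (ψ := fun x => x ^ (-a) * expNeg s (x ^ (-a))) (by fun_prop) (by fun_prop)
          (fun x => expNeg_le_one hs.le _) (by simp [expNeg, ha0])
          (by simp [ha0]) (B := ENNReal.ofReal (1 / s)) ENNReal.ofReal_ne_top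
          (fun x => mul_expNeg_le hs _) (lintegral_one_sub_expNeg ha hs).ge
    _ = ∫⁻ s in Set.Ioi (0 : ℝ), ∫⁻ z, f z * (∫⁻ u in Set.Ioi 0, D u s * L u z) ∂Q := by
        refine lintegral_congr fun s => ?_
        have hem := measurable_expNeg s
        have hm : Measurable fun p : 𝒵 × ℝ => ENNReal.ofReal p.2 ^ (-a) *
            expNeg s (ENNReal.ofReal p.2 ^ (-a)) * L p.2 p.1 := by fun_prop
        refine (lintegral_const_mul _ (hf.mul (Measurable.lintegral_prod_right' hm))).symm.trans
          (lintegral_congr fun z => ?_)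
        simp only [Pi.mul_apply]
        rw [mul_left_comm]
        congr 1
        refine (lintegral_const_mul _ (hm.comp (measurable_prodMk_left (x := z)))).symm.trans
          (lintegral_congr fun u => ?_)
        exact (mul_assoc _ _ _).symm
    _ = ∫⁻ z, f z * ∫⁻ u, L u z ∂ν ∂Q := by
        have hm : Measurable fun p : (ℝ × 𝒵) × ℝ => D p.2 p.1.1 * L p.2 p.1.2 :=
          (hD.comp (f := fun p : (ℝ × 𝒵) × ℝ => (p.2, p.1.1)) (by fun_prop)).mul (by fun_prop)
        have hm' : Measurable fun p : ℝ × 𝒵 => ∫⁻ u in Set.Ioi 0, D u p.1 * L u p.2 :=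
          Measurable.lintegral_prod_right' hm
        rw [lintegral_lintegral_swap (Measurable.aemeasurable (by
          unfold Function.uncurry; fun_prop))]
        refine lintegral_congr fun z => ?_
        refine (lintegral_const_mul _ (hm'.comp (measurable_prodMk_right (y := z)))).trans ?_
        congr 1
        have hLz : Measurable fun u => L u z := by fun_prop
        refine (lintegral_lintegral_swap (f := fun s u => D u s * L u z) (Measurable.aemeasurable
          (hm.comp (f := fun p : ℝ × ℝ => ((p.1, z), p.2)) (by fun_prop)))).trans ?_
        rw [lintegral_withDensity_eq_lintegral_mul _ measurable_selectedDensity hLz]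
        refine lintegral_congr fun u => ?_
        exact lintegral_mul_const _ (hD.comp (measurable_prodMk_left (x := u)))
    _ ≤ _ := by
        refine lintegral_mul_log_one_add_mul_le hf hf1 hνpos hη hη1 hcoeff0 ?_
        rw [lintegral_withDensity_eq_lintegral_mul _ measurable_selectedDensity (by fun_prop),
          hcoeff]
        exact (lintegral_rpow_mul_selectedDensity ha hη.le hηa).le

end finite

/-! ### Selection of the smallest tilted arrival time -/

section infinite

variable {𝒵 Ω : Type*} [MeasurableSpace 𝒵] [MeasurableSpace Ω] {μ : Measure Ω}
  [IsProbabilityMeasure μ] {T : ℕ → Ω → ℝ} {Z : ℕ → Ω → 𝒵} {Q : Measure 𝒵}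

/-- Almost surely some mark lies where the density does not vanish. -/
lemma IsMarkedPoisson.ae_exists_ne_zero (h : IsMarkedPoisson T Z Q μ) {f : 𝒵 → ℝ≥0∞}
    (hf : Measurable f) (hf1 : ∫⁻ z, f z ∂Q = 1) : ∀ᵐ ω ∂μ, ∃ i, f (Z i ω) ≠ 0 := by
  have hQ : IsProbabilityMeasure Q := (h.law_Z 0).isProbabilityMeasure_iff.1 inferInstance
  have hA : MeasurableSet {z | f z = 0} := hf (measurableSet_singleton 0)
  set q := Q {z | f z = 0} with hq
  have hq1 : q < 1 := by
    refine lt_of_le_of_ne prob_le_one fun h1 => ?_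
    have h2 : ∀ᵐ z ∂Q, f z = 0 := (prob_compl_eq_zero_iff hA).2 h1
    rw [lintegral_congr_ae h2] at hf1
    simp at hf1
  have hn : ∀ n : ℕ, μ {ω | ¬ ∃ i, f (Z i ω) ≠ 0} ≤ q ^ n := fun n => by
    have hg := h.lintegral_prod n (g := fun _ _ z => {z | f z = 0}.indicator 1 z)
      (fun _ => (measurable_one.indicator hA).comp measurable_snd)
    have hind : ∫⁻ z, {z | f z = 0}.indicator 1 z ∂Q = q := lintegral_indicator_one hA
    simp only [hind, Finset.prod_const, Finset.card_range, lintegral_const, measure_univ,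
      mul_one] at hg
    rw [← hg]
    refine (measure_mono (t := {ω | 1 ≤ ∏ i ∈ Finset.range n,
      {z | f z = 0}.indicator (1 : 𝒵 → ℝ≥0∞) (Z i ω)}) fun ω hω => ?_).trans ?_
    · simp only [Set.mem_ofPred_eq, not_exists, not_not] at hω ⊢
      exact (Finset.prod_eq_one fun i _ => by simp [hω i]).ge
    · have hm : Measurable fun ω => ∏ i ∈ Finset.range n,
          {z | f z = 0}.indicator (1 : 𝒵 → ℝ≥0∞) (Z i ω) :=
        Finset.measurable_prod _ fun i _ =>
          (measurable_one.indicator hA).comp (h.measurable_Z i)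
      simpa using mul_meas_ge_le_lintegral hm 1
  exact le_antisymm (ge_of_tendsto' (ENNReal.tendsto_pow_atTop_nhds_zero_of_lt_one hq1) hn) zero_le

/-- If `k` is selected, then its tilted arrival time lies in some cell `[lε, (l+1)ε)` and all
the others are at least `lε`. -/
lemma selectProb_top_le {ε : ℝ} (hε : 0 < ε) {τ : ℕ → ℝ≥0∞} (hτ : ∃ i, τ i ≠ ∞) (k : ℕ) :
    selectProb ∞ τ k ≤ ∑' l : ℕ,
      (if ENNReal.ofReal (l * ε) ≤ τ k ∧ τ k < ENNReal.ofReal ((l + 1) * ε) then 1 else 0) *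
      ⨅ n, ∏ i ∈ (Finset.range n).erase k, if ENNReal.ofReal (l * ε) ≤ τ i then 1 else 0 := by
  rw [selectProb, if_pos rfl]
  split_ifs with hk
  swap
  · exact zero_le
  obtain ⟨i, hi⟩ := hτ
  have hk' : τ k ≠ ∞ := ((hk.1 i).trans_lt hi.lt_top).ne
  obtain ⟨x, hx, hxk⟩ : ∃ x : ℝ, 0 ≤ x ∧ τ k = ENNReal.ofReal x :=
    ⟨(τ k).toReal, ENNReal.toReal_nonneg, (ENNReal.ofReal_toReal hk').symm⟩
  refine le_trans ?_ (ENNReal.le_tsum ⌊x / ε⌋₊)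
  have hle : ENNReal.ofReal (⌊x / ε⌋₊ * ε) ≤ τ k := by
    rw [hxk]
    refine ENNReal.ofReal_le_ofReal ?_
    rw [← le_div_iff₀ hε]
    exact Nat.floor_le (by positivity)
  have hlt : τ k < ENNReal.ofReal ((⌊x / ε⌋₊ + 1) * ε) := by
    rw [hxk, ENNReal.ofReal_lt_ofReal_iff (by positivity), ← div_lt_iff₀ hε]
    exact Nat.lt_floor_add_one _
  rw [if_pos ⟨hle, hlt⟩, one_mul]
  refine le_iInf fun n => (Finset.prod_eq_one fun i _ => ?_).ge
  rw [if_pos (hle.trans (hk.1 i))]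

/-- The refined bound for a fixed density and `α = ∞`: the decomposition into cells of length `ε`
costs a factor `exp ε`, which disappears as `ε → 0`. -/
lemma IsMarkedPoisson.tsum_log_mul_selectProb_top_le (h : IsMarkedPoisson T Z Q μ)
    {f : 𝒵 → ℝ≥0∞} (hf : Measurable f) (hf1 : ∫⁻ z, f z ∂Q = 1) {η : ℝ} (hη : 0 < η)
    (hη1 : η ≤ 1) :
    ∑' k : ℕ, ENNReal.ofReal (Real.log (k + 1)) *
      ∫⁻ ω, selectProb ∞ (tilted f (fun i => T i ω) (fun i => Z i ω)) k ∂μ ≤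
    ∫⁻ z, ENNReal.ofReal (klFun (f z).toReal) ∂Q +
      ENNReal.ofReal (1 / η * Real.log (gammaCoeff ∞ η + 1)) := by
  have hQ : IsProbabilityMeasure Q := (h.law_Z 0).isProbabilityMeasure_iff.1 inferInstance
  let τ : ℕ → Ω → ℝ≥0∞ := fun i ω => tilted f (fun i => T i ω) (fun i => Z i ω) i
  have hτ : ∀ i, Measurable (τ i) := h.measurable_tilted hf
  let L : ℝ → 𝒵 → ℝ≥0∞ := fun u z => ENNReal.ofReal (Real.log (1 + u * (f z).toReal))
  have hLm : ∀ z, Measurable fun u => L u z := fun z => by fun_prop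
  let φ : ℝ → ℕ → ℝ≥0∞ → ℝ≥0∞ := fun ε l x => if ENNReal.ofReal (l * ε) ≤ x then 1 else 0
  let ψ : ℝ → ℕ → ℝ≥0∞ → ℝ≥0∞ := fun ε l x =>
    if ENNReal.ofReal (l * ε) ≤ x ∧ x < ENNReal.ofReal ((l + 1) * ε) then 1 else 0
  have hφ : ∀ ε l, Measurable (φ ε l) := fun ε l =>
    Measurable.ite measurableSet_Ici measurable_const measurable_const
  have hψ : ∀ ε l, Measurable (ψ ε l) := fun ε l =>
    Measurable.ite (measurableSet_Ici.inter measurableSet_Iio) measurable_const measurable_const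
  let X : ℝ≥0∞ := ∫⁻ z, f z * (∫⁻ u in Set.Ioi 0, ENNReal.ofReal (Real.exp (-u)) * L u z) ∂Q
  have hε : ∀ ε : ℝ, 0 < ε → ∑' k : ℕ, ENNReal.ofReal (Real.log (k + 1)) *
      ∫⁻ ω, selectProb ∞ (tilted f (fun i => T i ω) (fun i => Z i ω)) k ∂μ ≤
      ENNReal.ofReal (Real.exp ε) * X := by
    intro ε hε
    calc _ ≤ ∑' k : ℕ, ENNReal.ofReal (Real.log (k + 1)) * ∑' l : ℕ,
          ∫⁻ ω, ψ ε l (τ k ω) * ⨅ n, ∏ i ∈ (Finset.range n).erase k, φ ε l (τ i ω) ∂μ := by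
          refine ENNReal.tsum_le_tsum fun k => mul_le_mul_right ?_ _
          rw [← lintegral_tsum]
          · refine lintegral_mono_ae ?_
            filter_upwards [h.ae_exists_ne_zero hf hf1] with ω hω
            refine selectProb_top_le hε ?_ k
            obtain ⟨i, hi⟩ := hω
            exact ⟨i, (ENNReal.div_lt_top ENNReal.ofReal_ne_top hi).ne⟩
          · intro l
            refine (((hψ ε l).comp (hτ k)).mul (Measurable.iInf fun n => ?_)).aemeasurable
            exact Finset.measurable_prod _ fun i _ => (hφ ε l).comp (hτ i)
      _ = ∑' l : ℕ, ∑' k : ℕ, ENNReal.ofReal (Real.log (k + 1)) *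
          ∫⁻ ω, ψ ε l (τ k ω) * ⨅ n, ∏ i ∈ (Finset.range n).erase k, φ ε l (τ i ω) ∂μ := by
          simp only [← ENNReal.tsum_mul_left]
          exact ENNReal.tsum_comm
      _ ≤ ∑' l : ℕ, ENNReal.ofReal (Real.exp (-(l * ε))) *
          ∫⁻ z, f z * (∫⁻ u in Set.Ioi 0, ψ ε l (ENNReal.ofReal u) * L u z) ∂Q := by
          refine ENNReal.tsum_le_tsum fun l => ?_
          refine h.tsum_log_mul_lintegral_le hf hf1 (hφ ε l) (hψ ε l) (B := 1)
            (fun x => ?_) (by simp [φ]) (by simp [ψ]) ENNReal.one_ne_top (fun x => ?_) ?_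
          · simp only [φ]; split_ifs <;> simp
          · simp only [ψ]; split_ifs <;> simp
          · have : ∀ u ∈ Set.Ioi (0 : ℝ), (Set.Ioo 0 (l * ε)).indicator 1 u ≤
                1 - φ ε l (ENNReal.ofReal u) := fun u hu => by
              by_cases hul : u < l * ε
              · have : ¬ ENNReal.ofReal (l * ε) ≤ ENNReal.ofReal u :=
                  not_le.2 ((ENNReal.ofReal_lt_ofReal_iff (lt_trans hu hul)).2 hul)
                have hφ0 : φ ε l (ENNReal.ofReal u) = 0 := if_neg this
                rw [Set.indicator_of_mem (show u ∈ Set.Ioo 0 (l * ε) from ⟨hu, hul⟩), hφ0]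
                simp
              · rw [Set.indicator_of_notMem (fun h => hul h.2)]
                exact zero_le
            refine le_trans (le_of_eq ?_) (setLIntegral_mono' measurableSet_Ioi this)
            rw [lintegral_indicator_one measurableSet_Ioo,
              Measure.restrict_apply measurableSet_Ioo, Set.inter_eq_left.2
              Set.Ioo_subset_Ioi_self, Real.volume_Ioo, sub_zero]
      _ = ∫⁻ z, f z * (∫⁻ u in Set.Ioi 0, (∑' l : ℕ, ENNReal.ofReal (Real.exp (-(l * ε))) *
            ψ ε l (ENNReal.ofReal u)) * L u z) ∂Q := by
          have hm : ∀ l, Measurable fun p : 𝒵 × ℝ => ψ ε l (ENNReal.ofReal p.2) * L p.2 p.1 :=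
            fun l => by have := hψ ε l; fun_prop
          have hm1 : ∀ l, Measurable fun z =>
              ∫⁻ u in Set.Ioi 0, ψ ε l (ENNReal.ofReal u) * L u z := fun l =>
            Measurable.lintegral_prod_right' (hm l)
          have hpull : ∀ l : ℕ, ENNReal.ofReal (Real.exp (-(l * ε))) *
              ∫⁻ z, f z * (∫⁻ u in Set.Ioi 0, ψ ε l (ENNReal.ofReal u) * L u z) ∂Q =
              ∫⁻ z, ENNReal.ofReal (Real.exp (-(l * ε))) *
                (f z * (∫⁻ u in Set.Ioi 0, ψ ε l (ENNReal.ofReal u) * L u z)) ∂Q := fun l =>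
            (lintegral_const_mul _ (hf.mul (hm1 l))).symm
          simp only [hpull]
          rw [← lintegral_tsum fun l => by have := hm1 l; fun_prop]
          refine lintegral_congr fun z => ?_
          have hmz : ∀ l, Measurable fun u => ψ ε l (ENNReal.ofReal u) * L u z := fun l =>
            (hm l).comp (measurable_prodMk_left (x := z))
          simp only [mul_left_comm _ (f z)]
          rw [ENNReal.tsum_mul_left]
          congr 1
          have hpull' : ∀ l : ℕ, ENNReal.ofReal (Real.exp (-(l * ε))) *
              ∫⁻ u in Set.Ioi 0, ψ ε l (ENNReal.ofReal u) * L u z =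
              ∫⁻ u in Set.Ioi 0, ENNReal.ofReal (Real.exp (-(l * ε))) *
                (ψ ε l (ENNReal.ofReal u) * L u z) := fun l =>
            (lintegral_const_mul _ (hmz l)).symm
          simp only [hpull']
          rw [← lintegral_tsum fun l => by have := hmz l; fun_prop]
          refine lintegral_congr fun u => ?_
          rw [← ENNReal.tsum_mul_right]
          exact tsum_congr fun l => (mul_assoc _ _ _).symm
      _ ≤ ∫⁻ z, f z * (∫⁻ u in Set.Ioi 0, ENNReal.ofReal (Real.exp ε) *
            (ENNReal.ofReal (Real.exp (-u)) * L u z)) ∂Q := by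
          refine lintegral_mono fun z => mul_le_mul_right ?_ _
          refine setLIntegral_mono' measurableSet_Ioi fun u hu => ?_
          have hu : 0 < u := hu
          rw [← mul_assoc]
          refine mul_le_mul_left ?_ _
          -- only the cell containing `u` contributes
          rw [tsum_eq_single ⌊u / ε⌋₊]
          · have hlt : u < (⌊u / ε⌋₊ + 1) * ε := by
              rw [← div_lt_iff₀ hε]; exact Nat.lt_floor_add_one _
            calc _ ≤ ENNReal.ofReal (Real.exp (-(⌊u / ε⌋₊ * ε))) * 1 := by
                  refine mul_le_mul_right ?_ _
                  simp only [ψ]; split_ifs <;> simp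
              _ ≤ _ := by
                  rw [mul_one, ← ENNReal.ofReal_mul (Real.exp_pos _).le, ← Real.exp_add]
                  exact ENNReal.ofReal_le_ofReal (Real.exp_le_exp.2 (by linarith))
          · intro l hl
            have : ¬ (ENNReal.ofReal (l * ε) ≤ ENNReal.ofReal u ∧
                ENNReal.ofReal u < ENNReal.ofReal ((l + 1) * ε)) := fun ⟨h1, h2⟩ => hl <| by
              rw [ENNReal.ofReal_le_ofReal_iff hu.le, ← le_div_iff₀ hε] at h1
              rw [ENNReal.ofReal_lt_ofReal_iff (by positivity), ← div_lt_iff₀ hε] at h2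
              exact ((Nat.floor_eq_iff (by positivity)).2 ⟨h1, h2⟩).symm
            have hψ0 : ψ ε l (ENNReal.ofReal u) = 0 := if_neg this
            rw [hψ0, mul_zero]
      _ = ENNReal.ofReal (Real.exp ε) * X := by
          have hm : Measurable fun p : 𝒵 × ℝ => ENNReal.ofReal (Real.exp (-p.2)) * L p.2 p.1 := by
            fun_prop
          refine Eq.trans (lintegral_congr fun z => ?_)
            (lintegral_const_mul _ (hf.mul (Measurable.lintegral_prod_right' hm)))
          rw [mul_left_comm]
          congr 1
          exact lintegral_const_mul _ (hm.comp (measurable_prodMk_left (x := z)))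
  have hlim : Filter.Tendsto (fun ε : ℝ => ENNReal.ofReal (Real.exp ε) * X)
      (nhdsWithin 0 (Set.Ioi 0)) (nhds (ENNReal.ofReal (Real.exp 0) * X)) := by
    refine ENNReal.Tendsto.mul_const ?_ (Or.inl (by simp))
    exact ENNReal.tendsto_ofReal ((Real.continuous_exp.tendsto 0).mono_left nhdsWithin_le_nhds)
  rw [Real.exp_zero, ENNReal.ofReal_one, one_mul] at hlim
  have hX := ge_of_tendsto hlim (Filter.eventually_of_mem self_mem_nhdsWithin fun ε hε' => hε ε hε')
  -- the selected tilted arrival time is exponentially distributed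
  let ν : Measure ℝ := (volume.restrict (Set.Ioi 0)).withDensity
    fun u => ENNReal.ofReal (Real.exp (-u))
  have hgamma : ∀ η : ℝ, 0 ≤ η → ∫⁻ u, ENNReal.ofReal (u ^ η) ∂ν =
      ENNReal.ofReal (Real.Gamma (η + 1)) := fun η hη => by
    rw [lintegral_withDensity_eq_lintegral_mul _ (by fun_prop) (by fun_prop),
      Real.Gamma_eq_integral (by linarith), ofReal_integral_eq_lintegral_ofReal]
    · refine lintegral_congr fun u => ?_
      rw [Pi.mul_apply, ← ENNReal.ofReal_mul (Real.exp_pos _).le, add_sub_cancel_right]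
    · exact Real.GammaIntegral_convergent (by linarith)
    · refine (ae_restrict_iff' measurableSet_Ioi).2 (ae_of_all _ fun u hu => ?_)
      have hu : 0 < u := hu
      simp only [Pi.zero_apply]
      positivity
  have hν : IsProbabilityMeasure ν := ⟨by simpa using hgamma 0 le_rfl⟩
  have hνpos : ∀ᵐ u ∂ν, 0 < u :=
    (withDensity_absolutelyContinuous _ _).ae_le (ae_restrict_mem measurableSet_Ioi)
  have hcoeff : gammaCoeff ∞ η = Real.Gamma (η + 1) := by simp [gammaCoeff]
  refine hX.trans ?_
  have hXν : X = ∫⁻ z, f z * ∫⁻ u, L u z ∂ν ∂Q := by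
    refine lintegral_congr fun z => ?_
    rw [lintegral_withDensity_eq_lintegral_mul _ (by fun_prop) (hLm z)]
    rfl
  rw [hXν]
  refine lintegral_mul_log_one_add_mul_le hf hf1 hνpos hη hη1 ?_ ?_
  · rw [hcoeff]; exact (Real.Gamma_pos_of_pos (by linarith)).le
  · rw [hcoeff, hgamma η hη.le]

end infinite

/-! ### Comparison of the two constants -/

/-- A lower bound for the Gamma function on `[1, 2]` from log-convexity, as
`2 = b (1 + b) + (1 - b) (2 + b)`. -/
lemma inv_rpow_le_Gamma_one_add {b : ℝ} (hb : 0 < b) (hb1 : b ≤ 1) :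
    ((1 + b) ^ (1 - b))⁻¹ ≤ Real.Gamma (1 + b) := by
  have hG : 0 < Real.Gamma (1 + b) := Real.Gamma_pos_of_pos (by linarith)
  rcases hb1.eq_or_lt with rfl | hb1
  · norm_num [Real.Gamma_two]
  have h := Real.Gamma_mul_add_mul_le_rpow_Gamma_mul_rpow_Gamma (s := 1 + b) (t := 2 + b)
    (by linarith) (by linarith) hb (sub_pos.2 hb1) (by ring)
  have e1 : b * (1 + b) + (1 - b) * (2 + b) = 2 := by ring
  have e2 : Real.Gamma (2 + b) = (1 + b) * Real.Gamma (1 + b) := by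
    rw [← Real.Gamma_add_one (by linarith)]; congr 1; ring
  rw [e1, Real.Gamma_two, e2, Real.mul_rpow (by linarith) hG.le, mul_left_comm,
    ← Real.rpow_add hG, add_sub_cancel, Real.rpow_one] at h
  rw [inv_le_iff_one_le_mul₀ (by positivity), mul_comm]
  exact h

lemma Gamma_le_one {x : ℝ} (h1 : 1 ≤ x) (h2 : x ≤ 2) : Real.Gamma x ≤ 1 := by
  have h := Real.convexOn_Gamma.2 (show (1 : ℝ) ∈ Set.Ioi 0 by simp)
    (show (2 : ℝ) ∈ Set.Ioi 0 by simp) (show 0 ≤ 2 - x by linarith)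
    (show 0 ≤ x - 1 by linarith) (by ring)
  simp only [smul_eq_mul, Real.Gamma_one, Real.Gamma_two, mul_one] at h
  have e : 2 - x + (x - 1) * 2 = x := by ring
  rw [e] at h
  linarith

/-- With `b = 1 - 1/α`, this is the case `α ≥ 3` of the comparison, where `η = 1`. -/
lemma gamma_ratio_le_of_two_thirds_le {b : ℝ} (hb : 2 / 3 ≤ b) (hb1 : b ≤ 1) :
    Real.Gamma (2 * b - 1) * Real.Gamma 2 / Real.Gamma b ^ (2 : ℝ) ≤ 2.56 := by
  have hb0 : 0 < b := by linarith
  have h2b : 0 < 2 * b - 1 := by linarith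
  have hG1 : 0 < Real.Gamma (1 + b) := Real.Gamma_pos_of_pos (by linarith)
  have hlow := inv_rpow_le_Gamma_one_add hb0 hb1
  have e1 : Real.Gamma b = Real.Gamma (1 + b) / b := by
    rw [add_comm, Real.Gamma_add_one hb0.ne']; field_simp
  have e2 : Real.Gamma (2 * b - 1) ≤ 1 / (2 * b - 1) := by
    rw [le_div_iff₀ h2b, mul_comm, ← Real.Gamma_add_one h2b.ne']
    exact Gamma_le_one (by linarith) (by linarith)
  have hpow : (1 + b) ^ (1 - b) ≤ Real.exp (b * (1 - b)) := by
    rw [Real.exp_mul]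
    exact Real.rpow_le_rpow (by linarith) (by linarith [Real.add_one_le_exp b]) (by linarith)
  have hexp : Real.exp (b * (1 - b)) ≤ 1.3 := by
    have h1 : b * (1 - b) ≤ 2 / 9 := by nlinarith
    have h2 : Real.exp (b * (1 - b)) ≤ 1 / (1 - b * (1 - b)) :=
      Real.exp_bound_div_one_sub_of_interval (by nlinarith) (by linarith)
    refine h2.trans ?_
    rw [div_le_iff₀ (by linarith)]
    linarith
  have hinv : 1 ≤ 1.3 * Real.Gamma (1 + b) := by
    have hp : 0 < (1 + b) ^ (1 - b) := by positivity
    rw [inv_le_iff_one_le_mul₀ hp] at hlow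
    nlinarith
  rw [Real.Gamma_two, mul_one, Real.rpow_two, e1, div_le_iff₀ (by positivity)]
  refine e2.trans ?_
  rw [div_pow, div_le_iff₀ h2b, mul_div_assoc', div_mul_eq_mul_div, le_div_iff₀ (by positivity)]
  have h3 : b ^ 2 ≤ 4 / 3 * (2 * b - 1) := by nlinarith
  have h4 : 1 ≤ 1.69 * Real.Gamma (1 + b) ^ 2 := by nlinarith
  nlinarith

/-- With `b = 1 - 1/α`, this is the case `α < 3` of the comparison, where `η = (α - 1) / 2`. -/
lemma gamma_ratio_le_of_lt_two_thirds {b η : ℝ} (hb : 0 < b) (hη : η = b / (2 * (1 - b)))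
    (hη1 : η ≤ 1) (hb1 : b < 1) :
    Real.Gamma (b / 2) * Real.Gamma (η + 1) / Real.Gamma b ^ (η + 1) ≤ 2.56 := by
  have hη0 : 0 < η := by rw [hη]; have := sub_pos.2 hb1; positivity
  have hb1' : 0 < 1 - b := by linarith
  have hG : 0 < Real.Gamma b := Real.Gamma_pos_of_pos hb
  have hlow := inv_rpow_le_Gamma_one_add hb hb1.le
  have e1 : Real.Gamma (b / 2) ≤ 2 / b := by
    rw [le_div_iff₀ hb]
    have h := Real.Gamma_add_one (show b / 2 ≠ 0 by positivity)
    have := Gamma_le_one (x := b / 2 + 1) (by linarith) (by linarith)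
    linarith
  have e2 : Real.Gamma (η + 1) ≤ 1 := Gamma_le_one (by linarith) (by linarith)
  -- a lower bound for `log Γ(b)`
  have hlogG : -Real.log b - (1 - b) * b ≤ Real.log (Real.Gamma b) := by
    have h1 : Real.log (Real.Gamma (1 + b)) = Real.log b + Real.log (Real.Gamma b) := by
      rw [add_comm, Real.Gamma_add_one hb.ne', Real.log_mul hb.ne' hG.ne']
    have h2 := Real.log_le_log (by positivity) hlow
    rw [Real.log_inv, Real.log_rpow (by linarith), h1] at h2
    have h3 : Real.log (1 + b) ≤ b := by
      linarith [Real.log_le_sub_one_of_pos (show 0 < 1 + b by linarith)]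
    have h4 := mul_le_mul_of_nonneg_left h3 hb1'.le
    linarith
  have hpow : Real.exp (-Real.log b - 1 / 8) ≤ Real.Gamma b ^ (η + 1) := by
    rw [Real.rpow_def_of_pos hG, Real.exp_le_exp]
    have h1 := mul_le_mul_of_nonneg_right hlogG (show 0 ≤ η + 1 by linarith)
    refine le_trans ?_ h1
    have h2 : Real.log b ≤ b - 1 := Real.log_le_sub_one_of_pos hb
    have h3 : η * (1 - b) = b / 2 := by rw [hη]; field_simp
    have h4 : η * Real.log b ≤ η * (b - 1) := mul_le_mul_of_nonneg_left h2 hη0.le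
    nlinarith [sq_nonneg (b - 1 / 2)]
  have hexp : Real.exp (1 / 8) ≤ 1.28 := by
    have := Real.exp_bound_div_one_sub_of_interval (x := 1 / 8) (by norm_num) (by norm_num)
    exact this.trans (by norm_num)
  have hpow' : 1 / b ≤ 1.28 * Real.Gamma b ^ (η + 1) := by
    have h1 : 1 / b = Real.exp (1 / 8) * Real.exp (-Real.log b - 1 / 8) := by
      rw [← Real.exp_add, add_sub_cancel, Real.exp_neg, Real.exp_log hb, one_div]
    rw [h1]
    exact mul_le_mul hexp hpow (Real.exp_pos _).le (by norm_num)
  have hGη : 0 < Real.Gamma (η + 1) := Real.Gamma_pos_of_pos (by linarith)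
  rw [div_le_iff₀ (by positivity)]
  have h1 : Real.Gamma (b / 2) * Real.Gamma (η + 1) ≤ 2 / b * 1 :=
    mul_le_mul e1 e2 hGη.le (by positivity)
  have h2 : 2 / b = 2 * (1 / b) := by ring
  linarith

lemma refinedGap_le_simpleGap {α : ℝ≥0∞} (hα : 1 < α) : refinedGap α ≤ simpleGap α := by
  have hα1 : 0 < α - 1 := tsub_pos_of_lt hα
  have hmtop : min ((α - 1) / 2) 1 ≠ ∞ := ((min_le_right _ _).trans_lt ENNReal.one_lt_top).ne
  have hmpos : 0 < min ((α - 1) / 2) 1 :=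
    lt_min (ENNReal.div_pos hα1.ne' (by simp)) one_pos
  set η := (min ((α - 1) / 2) 1).toReal with hηdef
  have hη : 0 < η := ENNReal.toReal_pos hmpos.ne' hmtop
  have hη1 : η ≤ 1 := by
    have := ENNReal.toReal_mono ENNReal.one_ne_top (min_le_right ((α - 1) / 2) 1)
    simpa using this
  have hηα : ENNReal.ofReal η < α - 1 := by
    rw [hηdef, ENNReal.ofReal_toReal hmtop]
    rcases eq_or_ne α ∞ with rfl | htop
    · simp
    · exact (min_le_left _ _).trans_lt (ENNReal.half_lt_self hα1.ne' (by simp [htop]))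
  have hα0 : 0 < α := zero_lt_one.trans hα
  set b := 1 - (α⁻¹).toReal with hbdef
  have hinv1 : (α⁻¹).toReal < 1 := by
    rw [← ENNReal.toReal_one]
    exact (ENNReal.toReal_lt_toReal (ENNReal.inv_ne_top.2 hα0.ne') ENNReal.one_ne_top).2
      (ENNReal.inv_lt_one.2 hα)
  have hb : 0 < b := by linarith
  have hb1 : b ≤ 1 := by have := ENNReal.toReal_nonneg (a := α⁻¹); linarith
  have hcoeff : gammaCoeff α η ≤ 2.56 := by
    rw [gammaCoeff, ← hbdef]
    rcases le_or_gt 3 α with h3 | h3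
    · have hηe : η = 1 := by
        have : 1 ≤ (α - 1) / 2 := by
          rw [ENNReal.le_div_iff_mul_le (by simp) (by simp)]
          refine le_trans ?_ (tsub_le_tsub_right h3 1)
          rw [one_mul]
          exact ENNReal.le_sub_of_add_le_right ENNReal.one_ne_top (by norm_num)
        rw [hηdef, min_eq_right this, ENNReal.toReal_one]
      have hinv3 : (α⁻¹).toReal ≤ 1 / 3 := by
        have := ENNReal.toReal_mono (by simp) (ENNReal.inv_le_inv.2 h3)
        simpa using this
      have := gamma_ratio_le_of_two_thirds_le (b := b) (by linarith) hb1
      rw [hηe]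
      convert this using 3
      · congr 1; rw [hbdef]; ring
      · norm_num
      · norm_num
    · have htop : α ≠ ∞ := (h3.trans (by simp)).ne
      set a := α.toReal with hadef
      have hα_eq : α = ENNReal.ofReal a := (ENNReal.ofReal_toReal htop).symm
      have ha1 : 1 < a := by
        rw [hadef, ← ENNReal.toReal_one]
        exact (ENNReal.toReal_lt_toReal ENNReal.one_ne_top htop).2 hα
      have hηe : η = (a - 1) / 2 := by
        have hle : (α - 1) / 2 ≤ 1 := by
          refine ENNReal.div_le_of_le_mul ?_
          rw [one_mul, tsub_le_iff_right]
          exact h3.le.trans (by norm_num)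
        rw [hηdef, min_eq_left hle, ENNReal.toReal_div,
          ENNReal.toReal_sub_of_le hα.le htop]
        simp [hadef]
      have hinva : (α⁻¹).toReal = a⁻¹ := ENNReal.toReal_inv α
      have ha0 : 0 < a := by linarith
      have hbe : η = b / (2 * (1 - b)) := by
        rw [hηe, hbdef, hinva]; field_simp; ring
      have := gamma_ratio_le_of_lt_two_thirds hb hbe hη1
        (by rw [hbdef, hinva]; have := inv_pos.2 ha0; linarith)
      convert this using 3
      congr 1
      rw [hbdef, hinva, hηe]; field_simp; ring
  have hcoeff0 : 0 ≤ gammaCoeff α η := by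
    have hp : 0 < 1 - (η + 1) * (α⁻¹).toReal := by
      rcases eq_or_ne α ∞ with rfl | htop
      · simp
      · rw [ENNReal.toReal_inv, ← div_eq_mul_inv, sub_pos,
          div_lt_one (ENNReal.toReal_pos hα0.ne' htop)]
        have hlt : η < (α - 1).toReal :=
          (ENNReal.ofReal_lt_iff_lt_toReal hη.le (by simp [htop])).1 hηα
        rw [ENNReal.toReal_sub_of_le hα.le htop, ENNReal.toReal_one] at hlt
        linarith
    have h1 := Real.Gamma_pos_of_pos hp
    have h2 := Real.Gamma_pos_of_pos (show 0 < η + 1 by linarith)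
    have h3 := Real.Gamma_pos_of_pos hb
    rw [gammaCoeff]; positivity
  refine (iInf₂_le η ⟨hη, hη1, hηα⟩).trans ?_
  rw [simpleGap, ← hηdef]
  refine ENNReal.ofReal_le_ofReal ?_
  rw [one_div, ← div_eq_inv_mul]
  gcongr
  linarith

/-! ### The bounds on the expected logarithm of the message -/

lemma measurable_selectProb (α : ℝ≥0∞) (k : ℕ) :
    Measurable fun τ : ℕ → ℝ≥0∞ => selectProb α τ k := by
  unfold selectProb
  by_cases hα : α = ∞
  · simp only [hα, if_true]
    refine Measurable.ite ?_ measurable_const measurable_const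
    have h1 : {τ : ℕ → ℝ≥0∞ | ∀ j, τ k ≤ τ j} = ⋂ j, {τ | τ k ≤ τ j} := by ext; simp
    have h2 : {τ : ℕ → ℝ≥0∞ | ∀ j < k, τ k < τ j} = ⋂ j, ⋂ _ : j < k, {τ | τ k < τ j} := by
      ext; simp
    refine MeasurableSet.inter (s₁ := {τ : ℕ → ℝ≥0∞ | ∀ j, τ k ≤ τ j})
      (s₂ := {τ : ℕ → ℝ≥0∞ | ∀ j < k, τ k < τ j}) ?_ ?_
    · rw [h1]
      exact MeasurableSet.iInter fun j =>
        measurableSet_le (measurable_pi_apply k) (measurable_pi_apply j)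
    · rw [h2]
      exact MeasurableSet.iInter fun j => MeasurableSet.iInter fun _ =>
        measurableSet_lt (measurable_pi_apply k) (measurable_pi_apply j)
  · simp only [hα, if_false]
    have : Measurable fun τ : ℕ → ℝ≥0∞ => ∑' i, τ i ^ (-α.toReal) :=
      Measurable.tsum fun i => (measurable_pi_apply i).pow_const _
    exact ((measurable_pi_apply k).pow_const _).div this

section

variable {𝒳 𝒵 Ω : Type*} [MeasurableSpace 𝒳] [MeasurableSpace 𝒵] [MeasurableSpace Ω]
  {α : ℝ≥0∞} {Q : Measure 𝒵} {κ : Kernel 𝒳 𝒵} {r : 𝒳 → 𝒵 → ℝ≥0∞} {μ : Measure Ω}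
  {X : Ω → 𝒳} {T : ℕ → Ω → ℝ} {Z : ℕ → Ω → 𝒵} {K : Ω → ℕ+}

lemma IsPPR.isMarkedPoisson (h : IsPPR α Q κ r μ X T Z K) : IsMarkedPoisson T Z Q μ where
  measurable := h.measurable_T
  iIndep_gap := h.iIndep_gap
  law_gap := h.law_gap
  measurable_Z := h.measurable_Z
  iIndep_Z := h.iIndep_Z
  law_Z := h.law_Z
  indep_T_Z := h.indep_T_Z

lemma IsPPR.expLog_eq_tsum (h : IsPPR α Q κ r μ X T Z K) :
    expLog μ K = ∑' k : ℕ, ENNReal.ofReal (Real.log (k + 1)) *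
      ∫⁻ ω, selectProb α (tilted (r (X ω)) (fun i => T i ω) (fun i => Z i ω)) k ∂μ := by
  have hpt : ∀ ω, ENNReal.ofReal (Real.log ((K ω : ℕ) : ℝ)) = ∑' k : ℕ,
      {ω | K ω = k.succPNat}.indicator (fun _ => ENNReal.ofReal (Real.log (k + 1))) ω := fun ω => by
    have hK : (K ω).natPred.succPNat = K ω := PNat.succPNat_natPred _
    rw [tsum_eq_single (K ω).natPred]
    · rw [Set.indicator_of_mem (show ω ∈ {ω | K ω = _} from hK.symm)]
      have : ((K ω : ℕ) : ℝ) = (K ω).natPred + 1 := by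
        exact_mod_cast (PNat.natPred_add_one (K ω)).symm
      rw [this]
    · intro k hk
      refine Set.indicator_of_notMem (fun hω => hk ?_) _
      rw [show K ω = k.succPNat from hω, Nat.natPred_succPNat]
  rw [expLog, lintegral_congr hpt,
    lintegral_tsum fun k => (measurable_const.indicator (h.measurable_K _)).aemeasurable]
  refine tsum_congr fun k => ?_
  rw [lintegral_indicator_const (h.measurable_K _)]
  congr 1
  simpa using h.cond_law k Set.univ MeasurableSet.univ

variable [IsProbabilityMeasure μ]

/-- The input is independent of the process, so the selection probabilities can be averaged
over the process for each value of the input. -/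
lemma IsPPR.lintegral_selectProb (h : IsPPR α Q κ r μ X T Z K) (k : ℕ) :
    ∫⁻ ω, selectProb α (tilted (r (X ω)) (fun i => T i ω) (fun i => Z i ω)) k ∂μ =
      ∫⁻ ω', ∫⁻ ω, selectProb α (tilted (r (X ω')) (fun i => T i ω) (fun i => Z i ω)) k ∂μ ∂μ := by
  have hTm : Measurable fun ω i => T i ω := measurable_pi_lambda _ h.measurable_T
  have hZm : Measurable fun ω i => Z i ω := measurable_pi_lambda _ h.measurable_Z
  have hTZm := hTm.prodMk hZm
  have hmap := h.indep_X.map_prod_eq_prod_map_map h.measurable_X.aemeasurable hTZm.aemeasurable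
  have hFm : Measurable fun p : 𝒳 × ((ℕ → ℝ) × (ℕ → 𝒵)) =>
      selectProb α (tilted (r p.1) p.2.1 p.2.2) k := by
    refine (measurable_selectProb α k).comp (measurable_pi_lambda _ fun i => ?_)
    have hr : Measurable fun p : 𝒳 × ((ℕ → ℝ) × (ℕ → 𝒵)) => r p.1 (p.2.2 i) :=
      h.measurable_r.comp (f := fun p : 𝒳 × ((ℕ → ℝ) × (ℕ → 𝒵)) => (p.1, p.2.2 i)) (by fun_prop)
    exact Measurable.div (by fun_prop) hr
  have : IsProbabilityMeasure (μ.map fun ω => ((fun i => T i ω), (fun i => Z i ω))) :=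
    Measure.isProbabilityMeasure_map hTZm.aemeasurable
  calc _ = ∫⁻ p, selectProb α (tilted (r p.1) p.2.1 p.2.2) k
        ∂((μ.map X).prod (μ.map fun ω => ((fun i => T i ω), (fun i => Z i ω)))) := by
        rw [← hmap, lintegral_map hFm (h.measurable_X.prodMk hTZm)]
    _ = ∫⁻ ω', ∫⁻ q, selectProb α (tilted (r (X ω')) q.1 q.2) k
        ∂(μ.map fun ω => ((fun i => T i ω), (fun i => Z i ω))) ∂μ := by
        rw [MeasureTheory.lintegral_prod _ hFm.aemeasurable]
        exact lintegral_map (Measurable.lintegral_prod_right' hFm) h.measurable_X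
    _ = _ := by
        refine lintegral_congr fun ω' => ?_
        exact lintegral_map (hFm.comp (measurable_prodMk_left (x := X ω'))) hTZm

variable [IsProbabilityMeasure Q] [IsMarkovKernel κ]

omit [IsProbabilityMeasure μ] in
lemma IsPPR.ae_withDensity_eq (h : IsPPR α Q κ r μ X T Z K) :
    ∀ᵐ ω ∂μ, Q.withDensity (r (X ω)) = κ (X ω) := by
  filter_upwards [h.ac, h.density] with ω h1 h2
  rw [withDensity_congr_ae h2, Measure.withDensity_rnDeriv_eq _ _ h1]

omit [IsProbabilityMeasure μ] [IsProbabilityMeasure Q] [IsMarkovKernel κ] in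
lemma IsPPR.measurable_density (h : IsPPR α Q κ r μ X T Z K) (x : 𝒳) : Measurable (r x) :=
  h.measurable_r.comp (measurable_prodMk_left (x := x))

/-- The refined bound for each admissible `η`, with the relative entropy expressed through the
density. -/
lemma IsPPR.expLog_le (h : IsPPR α Q κ r μ X T Z K) (hα : 1 < α) {η : ℝ} (hη : 0 < η)
    (hη1 : η ≤ 1) (hηα : ENNReal.ofReal η < α - 1) :
    expLog μ K ≤ ∫⁻ ω, ∫⁻ z, ENNReal.ofReal (klFun (r (X ω) z).toReal) ∂Q ∂μ +
      ENNReal.ofReal (1 / η * Real.log (gammaCoeff α η + 1)) := by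
  have hsel : ∀ k, Measurable fun ω' =>
      ∫⁻ ω, selectProb α (tilted (r (X ω')) (fun i => T i ω) (fun i => Z i ω)) k ∂μ := fun k => by
    refine Measurable.lintegral_prod_right' (f := fun p : Ω × Ω =>
      selectProb α (tilted (r (X p.1)) (fun i => T i p.2) (fun i => Z i p.2)) k) ?_
    refine (measurable_selectProb α k).comp (measurable_pi_lambda _ fun i => ?_)
    have hX := h.measurable_X
    have hTi := h.measurable_T i
    have hZi := h.measurable_Z i
    have hr : Measurable fun p : Ω × Ω => r (X p.1) (Z i p.2) :=
      h.measurable_r.comp (f := fun p : Ω × Ω => (X p.1, Z i p.2)) (by fun_prop)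
    exact Measurable.div (by fun_prop) hr
  calc expLog μ K = ∫⁻ ω', ∑' k : ℕ, ENNReal.ofReal (Real.log (k + 1)) *
        ∫⁻ ω, selectProb α (tilted (r (X ω')) (fun i => T i ω) (fun i => Z i ω)) k ∂μ ∂μ := by
        rw [h.expLog_eq_tsum, lintegral_tsum fun k => ((hsel k).const_mul _).aemeasurable]
        refine tsum_congr fun k => ?_
        rw [h.lintegral_selectProb, lintegral_const_mul _ (hsel k)]
    _ ≤ ∫⁻ ω', (∫⁻ z, ENNReal.ofReal (klFun (r (X ω') z).toReal) ∂Q +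
        ENNReal.ofReal (1 / η * Real.log (gammaCoeff α η + 1))) ∂μ := by
        refine lintegral_mono_ae ?_
        filter_upwards [h.ae_withDensity_eq] with ω' hω'
        have hf1 : ∫⁻ z, r (X ω') z ∂Q = 1 := by
          rw [← setLIntegral_univ, ← withDensity_apply _ MeasurableSet.univ, hω', measure_univ]
        rcases eq_or_ne α ∞ with rfl | htop
        · exact h.isMarkedPoisson.tsum_log_mul_selectProb_top_le (h.measurable_density _) hf1 hη hη1
        · exact h.isMarkedPoisson.tsum_log_mul_selectProb_le_of_ne_top (h.measurable_density _)
            hf1 hα htop hη hη1 hηα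
    _ = _ := by
        rw [lintegral_add_right _ measurable_const]
        simp

lemma IsPPR.expLog_le_add_refinedGap (h : IsPPR α Q κ r μ X T Z K) (hα : 1 < α) :
    expLog μ K ≤ ∫⁻ ω, ∫⁻ z, ENNReal.ofReal (klFun (r (X ω) z).toReal) ∂Q ∂μ +
      refinedGap α := by
  rw [← tsub_le_iff_left]
  refine le_iInf₂ fun η hη => ?_
  rw [tsub_le_iff_left]
  exact h.expLog_le hα hη.1 hη.2.1 hη.2.2

lemma IsPPR.lintegral_klFun_const {x : 𝒳} (h : IsPPR α Q κ r μ (fun _ => x) T Z K) :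
    ∫⁻ _, ∫⁻ z, ENNReal.ofReal (klFun (r x z).toReal) ∂Q ∂μ = klDiv (κ x) Q := by
  have hac : κ x ≪ Q := h.ac.exists.choose_spec
  have hd : r x =ᵐ[Q] (κ x).rnDeriv Q := h.density.exists.choose_spec
  rw [lintegral_const, measure_univ, mul_one, klDiv_eq_lintegral_klFun_of_ac hac]
  refine lintegral_congr_ae ?_
  filter_upwards [hd] with z hz
  rw [hz]

end

/-- For `Q` the output distribution, the averaged relative entropy is the mutual information. -/
lemma IsPPR.lintegral_klFun_eq_mutualInfo {𝒳 𝒵 Ω : Type*} [MeasurableSpace 𝒳]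
    [MeasurableSpace 𝒵] [MeasurableSpace Ω] {α : ℝ≥0∞} {κ : Kernel 𝒳 𝒵} [IsMarkovKernel κ]
    {r : 𝒳 → 𝒵 → ℝ≥0∞} {μ : Measure Ω} [IsProbabilityMeasure μ] {X : Ω → 𝒳} {T : ℕ → Ω → ℝ}
    {Z : ℕ → Ω → 𝒵} {K : Ω → ℕ+} (h : IsPPR α (κ ∘ₘ μ.map X) κ r μ X T Z K) :
    ∫⁻ ω, ∫⁻ z, ENNReal.ofReal (klFun (r (X ω) z).toReal) ∂(κ ∘ₘ μ.map X) ∂μ =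
      mutualInfo (μ.map X ⊗ₘ κ) := by
  have hP : IsProbabilityMeasure (μ.map X) :=
    Measure.isProbabilityMeasure_map h.measurable_X.aemeasurable
  set P := μ.map X with hPdef
  set Q := κ ∘ₘ P with hQdef
  have hrm := h.measurable_r
  have hρ : P ⊗ₘ κ = (P.prod Q).withDensity (Function.uncurry r) := by
    ext s hs
    rw [Measure.compProd_apply hs, withDensity_apply _ hs, ← lintegral_indicator hs,
      MeasureTheory.lintegral_prod _ (hrm.indicator hs).aemeasurable, hPdef,
      lintegral_map (Kernel.measurable_kernel_prodMk_left hs) h.measurable_X,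
      lintegral_map (Measurable.lintegral_prod_right' (hrm.indicator hs)) h.measurable_X]
    refine lintegral_congr_ae ?_
    filter_upwards [h.ae_withDensity_eq] with ω hω
    have hsx : MeasurableSet (Prod.mk (X ω) ⁻¹' s) := measurable_prodMk_left hs
    rw [← hω, withDensity_apply _ hsx, ← lintegral_indicator hsx]
    rfl
  have hac : P ⊗ₘ κ ≪ P.prod Q := hρ ▸ withDensity_absolutelyContinuous _ _
  have hrn : (P ⊗ₘ κ).rnDeriv (P.prod Q) =ᵐ[P.prod Q] Function.uncurry r := by
    rw [hρ]; exact Measure.rnDeriv_withDensity _ hrm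
  have hkm : Measurable fun p : 𝒳 × 𝒵 => ENNReal.ofReal (klFun (r p.1 p.2).toReal) :=
    (measurable_klFun.comp hrm.ennreal_toReal).ennreal_ofReal
  have hfst : (P ⊗ₘ κ).fst = P := Measure.fst_compProd _ _
  have hsnd : (P ⊗ₘ κ).snd = Q := Measure.snd_compProd _ _
  rw [mutualInfo, hfst, hsnd, klDiv_eq_lintegral_klFun_of_ac hac]
  symm
  calc _ = ∫⁻ p, ENNReal.ofReal (klFun (r p.1 p.2).toReal) ∂(P.prod Q) := by
        refine lintegral_congr_ae ?_
        filter_upwards [hrn] with p hp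
        rw [hp]; rfl
    _ = _ := by
        rw [MeasureTheory.lintegral_prod _ hkm.aemeasurable]
        conv_lhs => rw [hPdef]
        exact lintegral_map (Measurable.lintegral_prod_right' hkm) h.measurable_X

end PPR

theorem mainTheorem1 {𝒳 𝒵 Ω : Type*}
    [MeasurableSpace 𝒳] [MeasurableSpace 𝒵] [MeasurableSpace Ω]
    (α : ℝ≥0∞) (hα : 1 < α) (κ : Kernel 𝒳 𝒵) [IsMarkovKernel κ]
    (μ : Measure Ω) [IsProbabilityMeasure μ] :
    -- a fixed input `x` and an arbitrary proposal distribution `Q`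
    (∀ (Q : Measure 𝒵) [IsProbabilityMeasure Q] (x : 𝒳) (r : 𝒳 → 𝒵 → ℝ≥0∞)
        (T : ℕ → Ω → ℝ) (Z : ℕ → Ω → 𝒵) (K : Ω → ℕ+),
        PPR.IsPPR α Q κ r μ (fun _ => x) T Z K →
          PPR.expLog μ K ≤ klDiv (κ x) Q + PPR.simpleGap α ∧
          PPR.expLog μ K ≤ klDiv (κ x) Q + PPR.refinedGap α) ∧
    -- a random input `X`, with `Q = P_Z` the output distribution of the mechanism
    (∀ (X : Ω → 𝒳) (r : 𝒳 → 𝒵 → ℝ≥0∞)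
        (T : ℕ → Ω → ℝ) (Z : ℕ → Ω → 𝒵) (K : Ω → ℕ+),
        PPR.IsPPR α (κ ∘ₘ μ.map X) κ r μ X T Z K →
          PPR.expLog μ K ≤ PPR.mutualInfo (μ.map X ⊗ₘ κ) + PPR.simpleGap α ∧
          PPR.expLog μ K ≤ PPR.mutualInfo (μ.map X ⊗ₘ κ) + PPR.refinedGap α) ∧
    -- the refined constant improves on the simple one
    PPR.refinedGap α ≤ PPR.simpleGap α := by
  have hgap := PPR.refinedGap_le_simpleGap hα
  refine ⟨fun Q _ x r T Z K h => ?_, fun X r T Z K h => ?_, hgap⟩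
  · have := h.expLog_le_add_refinedGap hα
    rw [h.lintegral_klFun_const] at this
    exact ⟨this.trans (add_le_add_right hgap _), this⟩
  · have hP : IsProbabilityMeasure (μ.map X) :=
      Measure.isProbabilityMeasure_map h.measurable_X.aemeasurable
    have := h.expLog_le_add_refinedGap hα
    rw [h.lintegral_klFun_eq_mutualInfo] at this
    exact ⟨this.trans (add_le_add_right hgap _), this⟩
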